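/- A \emph{betweenness structure} is a pair $\mathcal B=(X,\beta)$ with $X$ a nonempty finite set and $\beta\subseteq X^3$; write $(x\,y\,z)$ for $(x,y,z)\in\beta$. All betweenness structures below are assumed to be almost-metrizable, i.e. for all $x,y,z,w\in X$: $(x\,x\,z)$; $(x\,y\,z)\Rightarrow(z\,y\,x)$; $(x\,y\,z)\wedge(y\,x\,z)\Rightarrow x=y$; and $(x\,y\,z)\wedge(x\,w\,y)\Rightarrow(x\,w\,z)\wedge(w\,y\,z)$. The order of $\mathcal B$ is $|X|$. A set of three distinct points is \emph{collinear} if it can be written as $\{x,y,z\}$ with $(x\,y\,z)$, and is a \emph{triangle} otherwise; the \emph{co-size} of $\mathcal B$ is its number of triangles, and $\mathcal B$ is \emph{linear} if its co-size is $0$. A connected graph $G$ with positive edge weights (equal to $1$ unless specified), with graph metric $d$, induces the betweenness structure $\mathcal B(G)$ on its vertex set in which $(x\,y\,z)$ holds if and only if $d(x,z)=d(x,y)+d(y,z)$. A betweenness structure is \emph{regular} if none of its induced substructures is isomorphic to $\mathcal B(C_4)$, where $C_4$ is the $4$-cycle. For $n\ge 4$ define the following weighted graphs on the vertex set $\{x_1,\dots,x_{n-2},y,z\}$,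 starting from the path $P=x_1x_2\cdots x_{n-2}$: \begin{itemize} \item $Q_n^3$: add to $P$ the edges $\{y,x_1\}$ and $\{z,x_1\}$; \item $R_{n,i}^3$, for $i\in I_n^3=\{1,\dots,n-3\}$: delete from $P$ the edge $\{x_i,x_{i+1}\}$, add the edges $\{y,x_i\}$, $\{z,x_i\}$, and add the edges $\{y,x_{i+1}\}$, $\{z,x_{i+1}\}$ of weight $2$; \item $S_n^3$: add to $P$ the edge $\{x_1,y\}$, the edge $\{x_{n-2},z\}$ of weight $2$, and the edge $\{y,z\}$ of weight $n-2$. \end{itemize} \textbf{Theorem.} For every $n\ge 3$, the minimum positive co-size of a regular betweenness structure of order $n$ exists and equals $\max\{1,n-3\}$. Further, up to isomorphism, the nonlinear regular betweenness structures whose co-size is minimum among the nonlinear regular betweenness structures of the same order are exactly $\mathcal B(Q_n^3)$ for $n\ge 4$, $\mathcal B(R_{n,i}^3)$ for $n\ge 4$ and $i\in I_n^3$, $\mathcal B(S_n^3)$ for $n\ge 4$, and $\mathcal B(K_3)$, where $K_3$ is the complete graph on three vertices. -/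

import Mathlib

universe u v

/-- A betweenness structure on the ground set `X`: a ternary relation, where `B.rel x y z` is read
"`y` is between `x` and `z`". -/
structure BetweennessStructure (X : Type u) where
  rel : X → X → X → Prop

namespace BetweennessStructure

variable {X : Type u} {Y : Type v}

/-- Almost-metrizable betweenness structures: the elementary properties of metric betweenness. -/
structure IsAlmostMetrizable (B : BetweennessStructure X) : Prop where
  left_self : ∀ x z, B.rel x x z
  symm : ∀ x y z, B.rel x y z → B.rel z y x
  eq_of_rel : ∀ x y z, B.rel x y z → B.rel y x z → x = y
  four_relations : ∀ x y z w, B.rel x y z → B.rel x w y → B.rel x w z ∧ B.rel w y z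

/-- The set of points `T` is of the form `{x, y, z}` with `y` between `x` and `z`. -/
def IsCollinear (B : BetweennessStructure X) (T : Finset X) : Prop :=
  ∃ x y z, (T : Set X) = {x, y, z} ∧ B.rel x y z

/-- The set of triangles: the non-collinear (unordered) triples of distinct points. -/
def triangles (B : BetweennessStructure X) : Set (Finset X) :=
  {T | T.card = 3 ∧ ¬ B.IsCollinear T}

/-- The co-size: the number of triangles. It is used for finite ground sets only. -/
noncomputable def coSize (B : BetweennessStructure X) : ℕ :=
  B.triangles.ncard

/-- A betweenness structure is linear if every triple of distinct points is collinear. -/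
def IsLinear (B : BetweennessStructure X) : Prop :=
  ∀ T : Finset X, T.card = 3 → B.IsCollinear T

/-- The substructure induced by a set of points. -/
def induce (B : BetweennessStructure X) (S : Set X) : BetweennessStructure S where
  rel x y z := B.rel x y z

/-- Isomorphism of betweenness structures. -/
def IsIsomorphic (B : BetweennessStructure X) (C : BetweennessStructure Y) : Prop :=
  ∃ e : X ≃ Y, ∀ x y z, B.rel x y z ↔ C.rel (e x) (e y) (e z)

/-- The betweenness structure induced by a distance function. -/
def ofDist (d : X → X → ℝ) : BetweennessStructure X where
  rel x y z := d x z = d x y + d y z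

end BetweennessStructure

/-- A simple graph with a positive real weight on every edge (values of `weight` at non-edges are
irrelevant). -/
structure WeightedGraph (V : Type u) where
  graph : SimpleGraph V
  weight : V → V → ℝ
  weight_symm : ∀ a b, weight a b = weight b a
  weight_pos : ∀ a b, graph.Adj a b → 0 < weight a b

namespace WeightedGraph

variable {V : Type u}

/-- The length of a walk: the sum of the weights of its edges. -/
def walkLength (W : WeightedGraph V) {a b : V} (p : W.graph.Walk a b) : ℝ :=
  (p.darts.map fun e => W.weight e.fst e.snd).sum

/-- The graph metric of a connected weighted graph: the length of a shortest walk. (As weights are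
positive, this is the length of a shortest path.) -/
noncomputable def dist (W : WeightedGraph V) (a b : V) : ℝ :=
  ⨅ p : W.graph.Walk a b, W.walkLength p

/-- The betweenness structure induced by a connected weighted graph. -/
noncomputable def betweenness (W : WeightedGraph V) : BetweennessStructure V :=
  BetweennessStructure.ofDist W.dist

/-- A simple graph as a weighted graph in which all weights are one. -/
def ofSimpleGraph (G : SimpleGraph V) : WeightedGraph V where
  graph := G
  weight _ _ := 1
  weight_symm _ _ := rfl
  weight_pos _ _ _ := one_pos

/-- The weighted graph given by a list of edges: a positive value `f a b` at distinct `a`, `b`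
means that there is an edge `{a, b}` of weight `f a b`. Every edge is listed in one direction,
and `f` is zero elsewhere. -/
noncomputable def ofEdges (f : V → V → ℝ) : WeightedGraph V where
  graph :=
    { Adj := fun a b => a ≠ b ∧ 0 < max (f a b) (f b a)
      symm := ⟨fun a b h => ⟨h.1.symm, by rw [max_comm]; exact h.2⟩⟩
      loopless := ⟨fun _ h => h.1 rfl⟩ }
  weight a b := max (f a b) (f b a)
  weight_symm a b := max_comm _ _
  weight_pos _ _ h := h.2

end WeightedGraph

/-- The vertex set `{x₁, …, xₙ₋₂, y, z}`; the vertex `xⱼ` is `x k` with `k + 1 = j`. -/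
inductive StarVertex (n : ℕ) : Type
  | x (k : Fin (n - 2)) : StarVertex n
  | y : StarVertex n
  | z : StarVertex n

open StarVertex in
/-- The graph `Qₙ³` (`n ≥ 4`): the path `x₁ x₂ … xₙ₋₂` with the edges `{y, x₁}` and `{z, x₁}`. -/
noncomputable def graphQ3 (n : ℕ) : WeightedGraph (StarVertex n) :=
  WeightedGraph.ofEdges fun a b =>
    match a, b with
    | x j, x k => if j.val + 1 = k.val then 1 else 0
    | y, x j => if j.val + 1 = 1 then 1 else 0
    | z, x j => if j.val + 1 = 1 then 1 else 0
    | _, _ => 0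

open StarVertex in
/-- The graph `Rₙ,ᵢ³` (`n ≥ 4`, `1 ≤ i ≤ n - 3`): the path `x₁ x₂ … xₙ₋₂` without the edge
`{xᵢ, xᵢ₊₁}`, with the edges `{y, xᵢ}`, `{z, xᵢ}` of weight `1` and the edges `{y, xᵢ₊₁}`,
`{z, xᵢ₊₁}` of weight `2`. -/
noncomputable def graphR3 (n i : ℕ) : WeightedGraph (StarVertex n) :=
  WeightedGraph.ofEdges fun a b =>
    match a, b with
    | x j, x k => if j.val + 1 = k.val ∧ j.val + 1 ≠ i then 1 else 0
    | y, x j => if j.val + 1 = i then 1 else if j.val + 1 = i + 1 then 2 else 0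
    | z, x j => if j.val + 1 = i then 1 else if j.val + 1 = i + 1 then 2 else 0
    | _, _ => 0

open StarVertex in
/-- The graph `Sₙ³` (`n ≥ 4`): the path `x₁ x₂ … xₙ₋₂` with the edge `{x₁, y}` of weight `1`, the
edge `{xₙ₋₂, z}` of weight `2` and the edge `{y, z}` of weight `n - 2`. -/
noncomputable def graphS3 (n : ℕ) : WeightedGraph (StarVertex n) :=
  WeightedGraph.ofEdges fun a b =>
    match a, b with
    | x j, x k => if j.val + 1 = k.val then 1 else 0
    | x j, y => if j.val + 1 = 1 then 1 else 0
    | x j, z => if j.val + 1 = n - 2 then 2 else 0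
    | y, z => (n : ℝ) - 2
    | _, _ => 0

/-- The betweenness structure `𝒞₄` induced by the cycle of order four. -/
noncomputable def cycleFour : BetweennessStructure (Fin 4) :=
  (WeightedGraph.ofSimpleGraph (SimpleGraph.cycleGraph 4)).betweenness

/-- The betweenness structure induced by the complete graph of order three. -/
noncomputable def completeThree : BetweennessStructure (Fin 3) :=
  (WeightedGraph.ofSimpleGraph (SimpleGraph.completeGraph (Fin 3))).betweenness

namespace BetweennessStructure

/-- A cyclic line: a set of points that induces a `𝒞₄` (such a substructure is linear). -/
def IsCyclicLine {X : Type u} (B : BetweennessStructure X) (S : Set X) : Prop :=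
  (B.induce S).IsIsomorphic cycleFour

/-- A betweenness structure is regular if it contains no cyclic line. -/
def IsRegular {X : Type u} (B : BetweennessStructure X) : Prop :=
  ¬ ∃ S : Set X, B.IsCyclicLine S

/-- There is an almost-metrizable betweenness structure of order `n` and co-size `m` with the
property `Φ`. -/
def Realizable (Φ : ∀ X : Type u, BetweennessStructure X → Prop) (n m : ℕ) : Prop :=
  ∃ (X : Type u) (_ : Finite X) (B : BetweennessStructure X),
    Nat.card X = n ∧ B.IsAlmostMetrizable ∧ Φ X B ∧ B.coSize = m

/-- `τ_Φ(n, k) = t`: the least `m > k` that is the co-size of an almost-metrizable betweenness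
structure of order `n` with the property `Φ` exists and is equal to `t`. -/
def IsTau (Φ : ∀ X : Type u, BetweennessStructure X → Prop) (n k t : ℕ) : Prop :=
  IsLeast {m : ℕ | k < m ∧ Realizable Φ n m} t

end BetweennessStructure

/-! The triangles form a system of triples, and two facts about five points control it: a regular
structure of order five has neither exactly one triangle (`not_one_triangle`) nor exactly two
triangles meeting in a single point (`not_two_triangles`). The lower bound `n - 3` is then pure
combinatorics. Deleting a point that lies in one triple but not in another destroys the first and
keeps the second, so induction on the point set gives `IsSparseFree.le_card`. When equality holds,
each deletion loses just one triple, and this forces all triples to share two points `y`, `z`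
(`IsSparseFree.exists_common_pair`).

In an extremal structure of order at least four, the complements of `y` and of `z` are therefore
linear, hence ordered by Menger's theorem (`exists_isRankOn`). There are `n - 2` further points and
`n - 3` triangles, so exactly one point `s` is collinear with `y` and `z`. If `s` lies between them,
every other point sees `y` and `z` alike: they are adjacent to `s` on the same side, and the
structure is `Q` or `R` according to whether they are at the end of the order
(`isIsomorphic_of_twins`). If `y` lies between `s` and `z`, then `y`, `s` start one order while `s`,
`z` are the ends of the other, which gives `S` (`isIsomorphic_graphS3`); the remaining case
exchanges `y` and `z`.

All three families have one shape: points on the integer line, with the single distance of `y` and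
`z` overwritten (`twistDist`). This turns the graph metrics, the extremality of the examples
(`isExtremalPair_twistDist`) and the final isomorphisms into integer arithmetic. -/

namespace BetweennessStructure

variable {X : Type u} {Y : Type v}

/-! ### Collinearity of named points and squares -/

/-- Some point of the triple `a`, `b`, `c` lies between the other two. -/
def Collinear (B : BetweennessStructure X) (a b c : X) : Prop :=
  B.rel a b c ∨ B.rel b a c ∨ B.rel a c b

/-- The points `a`, `b`, `c`, `d` form, in this cyclic order, a cyclic line. -/
structure IsSquare (B : BetweennessStructure X) (a b c d : X) : Prop where
  ne_ab : a ≠ b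
  ne_ac : a ≠ c
  ne_ad : a ≠ d
  ne_bc : b ≠ c
  ne_bd : b ≠ d
  ne_cd : c ≠ d
  abc : B.rel a b c
  bcd : B.rel b c d
  cda : B.rel c d a
  dab : B.rel d a b

namespace IsAlmostMetrizable

variable {B : BetweennessStructure X}

theorem right_self (hB : B.IsAlmostMetrizable) (x z : X) : B.rel x z z :=
  hB.symm _ _ _ (hB.left_self z x)

theorem comm (hB : B.IsAlmostMetrizable) {x y z : X} : B.rel x y z ↔ B.rel z y x :=
  ⟨hB.symm _ _ _, hB.symm _ _ _⟩

theorem rel_self_iff (hB : B.IsAlmostMetrizable) {x y : X} : B.rel x y x ↔ x = y :=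
  ⟨fun h => hB.eq_of_rel _ _ _ h (hB.right_self y x), fun h => h ▸ hB.left_self x x⟩

theorem not_left (hB : B.IsAlmostMetrizable) {x y z : X} (h : B.rel x y z) (hne : x ≠ y) :
    ¬ B.rel y x z := fun h' => hne (hB.eq_of_rel _ _ _ h h')

theorem not_right (hB : B.IsAlmostMetrizable) {x y z : X} (h : B.rel x y z) (hne : y ≠ z) :
    ¬ B.rel x z y := fun h' =>
  hne (hB.eq_of_rel _ _ _ (hB.symm _ _ _ h) (hB.symm _ _ _ h')).symm

theorem collinear_swap_left (hB : B.IsAlmostMetrizable) {a b c : X} :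
    B.Collinear a b c ↔ B.Collinear b a c := by
  unfold Collinear
  rw [hB.comm (x := a) (y := c)]
  tauto

theorem collinear_swap_right (hB : B.IsAlmostMetrizable) {a b c : X} :
    B.Collinear a b c ↔ B.Collinear a c b := by
  unfold Collinear
  rw [hB.comm (x := b) (y := a)]
  tauto

theorem isCollinear_iff [DecidableEq X] (hB : B.IsAlmostMetrizable) {a b c : X} (hab : a ≠ b)
    (hac : a ≠ c) (hbc : b ≠ c) : B.IsCollinear {a, b, c} ↔ B.Collinear a b c := by
  constructor
  · rintro ⟨x, y, z, h, hr⟩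
    have key : ∀ w, (w = a ∨ w = b ∨ w = c) ↔ (w = x ∨ w = y ∨ w = z) := fun w => by
      have := Set.ext_iff.1 h w
      simpa using this
    have hx := (key x).2 (by simp)
    have hy := (key y).2 (by simp)
    have hz := (key z).2 (by simp)
    have ha := (key a).1 (by simp)
    have hb := (key b).1 (by simp)
    have hc := (key c).1 (by simp)
    have hr' := hB.symm _ _ _ hr
    clear h key
    unfold Collinear
    rcases hx with rfl | rfl | rfl <;> rcases hy with rfl | rfl | rfl <;>
      rcases hz with rfl | rfl | rfl <;> tauto
  · rintro (h | h | h)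
    · exact ⟨a, b, c, by simp, h⟩
    · exact ⟨b, a, c, by simp [Set.insert_comm], h⟩
    · exact ⟨a, c, b, by simp [Set.pair_comm], h⟩

end IsAlmostMetrizable

/-! ### Linear regular sets are ordered -/

/-- `f` numbers the points of `S` in an order that describes the betweenness on `S`. -/
structure IsRankOn (B : BetweennessStructure X) (S : Finset X) (f : X → ℕ) : Prop where
  inj : ∀ a ∈ S, ∀ b ∈ S, f a = f b → a = b
  lt : ∀ a ∈ S, f a < S.card
  rel_iff : ∀ a ∈ S, ∀ b ∈ S, ∀ c ∈ S,
    B.rel a b c ↔ (f a ≤ f b ∧ f b ≤ f c) ∨ (f c ≤ f b ∧ f b ≤ f a)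

theorem IsRankOn.surj {B : BetweennessStructure X} {S : Finset X} {f : X → ℕ}
    (hf : B.IsRankOn S f) {k : ℕ} (hk : k < S.card) : ∃ a ∈ S, f a = k := by
  obtain ⟨a, ha, h⟩ := Finset.surj_on_of_inj_on_of_card_le (s := S) (t := Finset.range S.card)
    (fun a _ => f a) (fun a ha => Finset.mem_range.2 (hf.lt a ha))
    (fun a b ha hb h => hf.inj a ha b hb h) (by simp) k (Finset.mem_range.2 hk)
  exact ⟨a, ha, h.symm⟩

/-- Betweenness determines the order only up to reversal; this allows `s` to be put on a chosen side
of `y`. -/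
theorem IsRankOn.rev {B : BetweennessStructure X} {S : Finset X} {f : X → ℕ}
    (hf : B.IsRankOn S f) : B.IsRankOn S (fun a => S.card - 1 - f a) where
  inj a ha b hb h := hf.inj a ha b hb (by
    have := hf.lt a ha; have := hf.lt b hb; omega)
  lt a ha := by have := hf.lt a ha; omega
  rel_iff a ha b hb c hc := by
    rw [hf.rel_iff a ha b hb c hc]
    have := hf.lt a ha; have := hf.lt b hb; have := hf.lt c hc
    omega

section Rank

variable {B : BetweennessStructure X} {S : Finset X}

/-- A finite linear set contains two points such that all its points are between them. -/
theorem exists_ends (hB : B.IsAlmostMetrizable) (hS : S.Nonempty)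
    (hcol : ∀ a ∈ S, ∀ b ∈ S, ∀ c ∈ S, B.Collinear a b c) :
    ∃ a ∈ S, ∃ b ∈ S, ∀ x ∈ S, B.rel a x b := by
  classical
  -- The ends are a pair with the most points between them: a point outside could replace one of the
  -- two and enclose strictly more.
  obtain ⟨⟨a, b⟩, hab, hmax⟩ := Finset.exists_max_image (S ×ˢ S)
    (fun q => (S.filter fun x => B.rel q.1 x q.2).card) (hS.product hS)
  obtain ⟨ha, hb⟩ := Finset.mem_product.1 hab
  refine ⟨a, ha, b, hb, fun x hx => ?_⟩
  by_contra hxb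
  have grow : ∀ c d, c ∈ S → d ∈ S →
      (∀ y, B.rel a y b → B.rel c y d) → B.rel c x d → False := by
    intro c d hc hd h1 h2
    have := hmax (c, d) (Finset.mem_product.2 ⟨hc, hd⟩)
    refine absurd this (not_le.2 (Finset.card_lt_card ?_))
    refine Finset.ssubset_iff_subset_ne.2 ⟨fun y hy => ?_, fun h => hxb ?_⟩
    · simp only [Finset.mem_filter] at hy ⊢
      exact ⟨hy.1, h1 y hy.2⟩
    · have : x ∈ S.filter fun y => B.rel c y d := Finset.mem_filter.2 ⟨hx, h2⟩
      rw [← h] at this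
      exact (Finset.mem_filter.1 this).2
  rcases hcol a ha x hx b hb with h | h | h
  · exact hxb h
  · refine grow x b hx hb (fun y hy => ?_) (hB.left_self _ _)
    exact hB.symm _ _ _
      (hB.four_relations b a x y (hB.symm _ _ _ h) (hB.symm _ _ _ hy)).1
  · exact grow a x ha hx (fun y hy => (hB.four_relations a b x y h hy).1) (hB.right_self _ _)

/-- Menger's theorem: a finite linear set without cyclic lines is ordered. -/
theorem exists_isRankOn (hB : B.IsAlmostMetrizable) (hreg : ∀ a b c d, ¬ B.IsSquare a b c d)
    (hcol : ∀ a ∈ S, ∀ b ∈ S, ∀ c ∈ S, B.Collinear a b c) : ∃ f, B.IsRankOn S f := by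
  classical
  rcases S.eq_empty_or_nonempty with rfl | hS
  · exact ⟨fun _ => 0, by simp, by simp, by simp⟩
  obtain ⟨a, ha, b, hb, hab⟩ := exists_ends hB hS hcol
  -- Seen from the end `a`, any two points are comparable. Otherwise `a` lies between `x` and `y`;
  -- then either `b` does too, and `a x b y` is a square, or the axioms restore comparability.
  have tot : ∀ x ∈ S, ∀ y ∈ S, B.rel a x y ∨ B.rel a y x := by
    intro x hx y hy
    by_contra! hne
    obtain ⟨h1, h2⟩ := hne
    have hxay : B.rel x a y := by
      rcases hcol a ha x hx y hy with h | h | h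
      · exact absurd h h1
      · exact h
      · exact absurd h h2
    have hxa : x ≠ a := by rintro rfl; exact h1 (hB.left_self _ _)
    have hya : y ≠ a := by rintro rfl; exact h2 (hB.left_self _ _)
    have hxy : x ≠ y := by rintro rfl; exact h1 (hB.right_self _ _)
    have hxb := hab x hx
    have hyb := hab y hy
    have hab' : a ≠ b := by rintro rfl; exact hxa (hB.rel_self_iff.1 hxb).symm
    have hxb' : x ≠ b := by rintro rfl; exact h2 hyb
    have hyb' : y ≠ b := by rintro rfl; exact h1 hxb
    rcases hcol x hx b hb y hy with h | h | h
    · exact hreg a x b y ⟨hxa.symm, hab', hya.symm, hxb', hxy, hyb'.symm, hxb, h,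
        hB.symm _ _ _ hyb, hB.symm _ _ _ hxay⟩
    · exact h2 (hB.symm _ _ _ (hB.four_relations b y a x (hB.symm _ _ _ hyb) h).2)
    · exact h1 (hB.symm _ _ _
        (hB.four_relations b x a y (hB.symm _ _ _ hxb) (hB.symm _ _ _ h)).2)
  have anti : ∀ x y, B.rel a x y → B.rel a y x → x = y := fun x y h1 h2 =>
    hB.eq_of_rel _ _ _ (hB.symm _ _ _ h2) (hB.symm _ _ _ h1)
  have trans : ∀ x y z, B.rel a x y → B.rel a y z → B.rel a x z ∧ B.rel x y z :=
    fun x y z h1 h2 => hB.four_relations a y z x h2 h1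
  -- The rank of a point is the number of points strictly before it, seen from `a`.
  let f : X → ℕ := fun x => (S.filter fun w => B.rel a w x ∧ w ≠ x).card
  have mono : ∀ x ∈ S, ∀ y ∈ S, B.rel a x y → x ≠ y → f x < f y := by
    intro x hx y hy h hne
    refine Finset.card_lt_card (Finset.ssubset_iff_subset_ne.2 ⟨fun w hw => ?_, fun e => ?_⟩)
    · simp only [Finset.mem_filter] at hw ⊢
      refine ⟨hw.1, (trans w x y hw.2.1 h).1, ?_⟩
      rintro rfl
      exact hne (anti _ _ h hw.2.1)
    · have : x ∈ S.filter fun w => B.rel a w y ∧ w ≠ y := Finset.mem_filter.2 ⟨hx, h, hne⟩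
      rw [← e] at this
      exact (Finset.mem_filter.1 this).2.2 rfl
  have le_iff : ∀ x ∈ S, ∀ y ∈ S, (B.rel a x y ↔ f x ≤ f y) := by
    intro x hx y hy
    constructor
    · intro h
      by_cases e : x = y
      · rw [e]
      · exact (mono x hx y hy h e).le
    · intro h
      rcases tot x hx y hy with h' | h'
      · exact h'
      · by_cases e : y = x
        · exact e ▸ hB.right_self _ _
        · exact absurd (mono y hy x hx h' e) (not_lt.2 h)
  have btw : ∀ x ∈ S, ∀ y ∈ S, ∀ z ∈ S, f x ≤ f y → f y ≤ f z → B.rel x y z := by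
    intro x hx y hy z hz h1 h2
    exact (trans x y z ((le_iff x hx y hy).2 h1) ((le_iff y hy z hz).2 h2)).2
  have inj : ∀ x ∈ S, ∀ y ∈ S, f x = f y → x = y := fun x hx y hy h =>
    anti _ _ ((le_iff x hx y hy).2 h.le) ((le_iff y hy x hx).2 h.ge)
  have between : ∀ x ∈ S, ∀ y ∈ S, ∀ z ∈ S, B.rel x y z → f x ≤ f z → f x ≤ f y ∧ f y ≤ f z := by
    intro x hx y hy z hz h h3
    constructor
    · by_contra! h1
      have := hB.eq_of_rel _ _ _ h (btw y hy x hx z hz h1.le h3)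
      subst this; exact lt_irrefl _ h1
    · by_contra! h1
      have := hB.eq_of_rel _ _ _ (hB.symm _ _ _ h) (hB.symm _ _ _ (btw x hx z hz y hy h3 h1.le))
      subst this; exact lt_irrefl _ h1
  refine ⟨f, inj, fun x hx => ?_, ?_⟩
  · refine Finset.card_lt_card (Finset.ssubset_iff_subset_ne.2 ⟨Finset.filter_subset _ _, fun e => ?_⟩)
    rw [← e] at hx
    exact (Finset.mem_filter.1 hx).2.2 rfl
  · intro x hx y hy z hz
    constructor
    · intro h
      rcases le_total (f x) (f z) with h3 | h3
      · exact .inl (between x hx y hy z hz h h3)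
      · exact .inr (between z hz y hy x hx (hB.symm _ _ _ h) h3)
    · rintro (⟨h1, h2⟩ | ⟨h1, h2⟩)
      · exact btw x hx y hy z hz h1 h2
      · exact hB.symm _ _ _ (btw z hz y hy x hx h1 h2)

end Rank

end BetweennessStructure

/-! ### Computing graph metrics -/

namespace WeightedGraph

variable {V : Type u}

theorem walkLength_nil (W : WeightedGraph V) (a : V) :
    W.walkLength (SimpleGraph.Walk.nil : W.graph.Walk a a) = 0 := by
  simp [walkLength]

theorem walkLength_cons (W : WeightedGraph V) {a b c : V} (h : W.graph.Adj a b)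
    (p : W.graph.Walk b c) : W.walkLength (.cons h p) = W.weight a b + W.walkLength p := by
  simp [walkLength]

theorem walkLength_append (W : WeightedGraph V) {a b c : V} (p : W.graph.Walk a b)
    (q : W.graph.Walk b c) : W.walkLength (p.append q) = W.walkLength p + W.walkLength q := by
  simp [walkLength]

theorem walkLength_reverse (W : WeightedGraph V) {a b : V} (p : W.graph.Walk a b) :
    W.walkLength p.reverse = W.walkLength p := by
  induction p with
  | nil => simp
  | cons h p ih =>
    rw [SimpleGraph.Walk.reverse_cons, walkLength_append, walkLength_cons, walkLength_cons,
      walkLength_nil, ih, W.weight_symm]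
    ring

/-- A function that is `1`-Lipschitz along the edges and is attained step by step is the graph
metric. -/
theorem dist_eq_of_steps (W : WeightedGraph V) (d : V → V → ℕ) (hself : ∀ a, d a a = 0)
    (hsymm : ∀ a b, d a b = d b a)
    (hle : ∀ a b c, W.graph.Adj a c → (d a b : ℝ) ≤ W.weight a c + d c b)
    (hstep : ∀ a b, a ≠ b → ∃ c, (W.graph.Adj a c ∧ (d a b : ℝ) = W.weight a c + d c b) ∨
      (W.graph.Adj b c ∧ (d b a : ℝ) = W.weight b c + d c a)) (a b : V) :
    W.dist a b = d a b := by
  have lower : ∀ (a b : V) (p : W.graph.Walk a b), (d a b : ℝ) ≤ W.walkLength p := by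
    intro a b p
    induction p with
    | nil => simp [hself, walkLength_nil]
    | cons h p ih =>
      rw [walkLength_cons]
      exact (hle _ _ _ h).trans (by gcongr)
  -- Natural values make induction possible: a step along an edge of positive weight strictly lowers
  -- the remaining distance.
  have upper : ∀ (k : ℕ) (a b : V), d a b = k → ∃ p : W.graph.Walk a b, W.walkLength p = d a b := by
    intro k
    induction k using Nat.strong_induction_on with
    | _ k ih =>
      have walk : ∀ a b c, d a b = k → W.graph.Adj a c → (d a b : ℝ) = W.weight a c + d c b →
          ∃ p : W.graph.Walk a b, W.walkLength p = d a b := by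
        intro a b c hk h e
        have hpos := W.weight_pos _ _ h
        have hlt : d c b < k := by
          rw [← hk]
          exact_mod_cast (by linarith : (d c b : ℝ) < d a b)
        obtain ⟨p, hp⟩ := ih _ hlt c b rfl
        exact ⟨.cons h p, by rw [walkLength_cons, hp, e]⟩
      intro a b hk
      by_cases hab : a = b
      · subst hab
        exact ⟨.nil, by simp [hself, walkLength_nil]⟩
      obtain ⟨c, ⟨h, e⟩ | ⟨h, e⟩⟩ := hstep a b hab
      · exact walk a b c hk h e
      · obtain ⟨p, hp⟩ := walk b a c (by rw [hsymm, hk]) h e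
        exact ⟨p.reverse, by rw [walkLength_reverse, hp, hsymm]⟩
  obtain ⟨p, hp⟩ := upper _ a b rfl
  have : Nonempty (W.graph.Walk a b) := ⟨p⟩
  refine le_antisymm ?_ (le_ciInf fun q => lower a b q)
  rw [← hp]
  exact ciInf_le ⟨(d a b : ℝ), by rintro _ ⟨q, rfl⟩; exact lower a b q⟩ p

theorem ofEdges_dist_eq (f : V → V → ℝ) (d : V → V → ℕ) (hself : ∀ a, d a a = 0)
    (hsymm : ∀ a b, d a b = d b a)
    (hle : ∀ a b c, 0 < f a c → (d a b : ℝ) ≤ f a c + d c b ∧ (d c b : ℝ) ≤ f a c + d a b)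
    (hstep : ∀ a b, a ≠ b → ∃ c, ((ofEdges f).graph.Adj a c ∧
        (d a b : ℝ) = (ofEdges f).weight a c + d c b) ∨
      ((ofEdges f).graph.Adj b c ∧ (d b a : ℝ) = (ofEdges f).weight b c + d c a)) (a b : V) :
    (ofEdges f).dist a b = d a b := by
  refine dist_eq_of_steps _ d hself hsymm (fun a b c h => ?_) hstep a b
  have h1 : (ofEdges f).weight a c = max (f a c) (f c a) := rfl
  rw [h1]
  rcases lt_max_iff.1 h.2 with h | h
  · exact (hle a b c h).1.trans (by gcongr; exact le_max_left _ _)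
  · exact (hle c b a h).2.trans (by gcongr; exact le_max_right _ _)

end WeightedGraph

/-! ### Betweenness from natural distances, and regularity in terms of squares -/

namespace BetweennessStructure

variable {X : Type u} {Y : Type v}

/-- The betweenness structure induced by a distance function with natural values. -/
def ofNatDist (d : X → X → ℕ) : BetweennessStructure X where
  rel a b c := d a c = d a b + d b c

theorem betweenness_rel_iff (W : WeightedGraph X) (d : X → X → ℕ)
    (h : ∀ a b, W.dist a b = d a b) (a b c : X) :
    W.betweenness.rel a b c ↔ (ofNatDist d).rel a b c := by
  change W.dist a c = W.dist a b + W.dist b c ↔ d a c = d a b + d b c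
  rw [h, h, h]
  norm_cast

theorem ofNatDist_isAlmostMetrizable (d : X → X → ℕ) (hself : ∀ a, d a a = 0)
    (hpos : ∀ a b, d a b = 0 → a = b) (hsymm : ∀ a b, d a b = d b a)
    (htri : ∀ a b c, d a c ≤ d a b + d b c) : (ofNatDist d).IsAlmostMetrizable where
  left_self x z := by simp [ofNatDist, hself]
  symm x y z h := by
    simp only [ofNatDist] at h ⊢
    rw [hsymm z x, hsymm z y, hsymm y x]; omega
  eq_of_rel x y z h h' := by
    simp only [ofNatDist] at h h'
    have := hsymm x y
    exact hpos _ _ (by omega)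
  four_relations x y z w h h' := by
    simp only [ofNatDist] at h h' ⊢
    have := htri x w z
    have := htri w y z
    have := htri x y z
    omega

theorem cycleFour_rel_iff (a b c : Fin 4) : cycleFour.rel a b c ↔
    (ofNatDist fun a b : Fin 4 => if a = b then 0 else if a + 2 = b then 2 else 1).rel a b c := by
  refine betweenness_rel_iff _ _ (WeightedGraph.dist_eq_of_steps _ _ ?_ ?_ ?_ ?_) a b c
  · decide
  · decide
  · have : ∀ a b c : Fin 4, (SimpleGraph.cycleGraph 4).Adj a c →
        (if a = b then 0 else if a + 2 = b then 2 else 1) ≤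
          1 + (if c = b then 0 else if c + 2 = b then 2 else 1) := by decide
    intro a b c h
    have := this a b c h
    dsimp only [WeightedGraph.ofSimpleGraph]
    exact_mod_cast this
  · have : ∀ a b : Fin 4, a ≠ b → ∃ c, (SimpleGraph.cycleGraph 4).Adj a c ∧
        (if a = b then 0 else if a + 2 = b then 2 else 1) =
          1 + (if c = b then 0 else if c + 2 = b then 2 else 1) := by decide
    intro a b h
    obtain ⟨c, h1, h2⟩ := this a b h
    refine ⟨c, .inl ⟨h1, ?_⟩⟩
    dsimp only [WeightedGraph.ofSimpleGraph]
    exact_mod_cast h2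

theorem completeThree_rel_iff (a b c : Fin 3) : completeThree.rel a b c ↔
    (ofNatDist fun a b : Fin 3 => if a = b then 0 else 1).rel a b c := by
  refine betweenness_rel_iff _ _ (WeightedGraph.dist_eq_of_steps _ _ ?_ ?_ ?_ ?_) a b c
  · decide
  · decide
  · have : ∀ a b c : Fin 3, a ≠ c → (if a = b then 0 else 1) ≤
          1 + (if c = b then 0 else 1) := by decide
    intro a b c h
    have := this a b c h
    dsimp only [WeightedGraph.ofSimpleGraph]
    exact_mod_cast this
  · intro a b h
    exact ⟨b, .inl ⟨h, by simp [h, WeightedGraph.ofSimpleGraph]⟩⟩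

instance (d : X → X → ℕ) (a b c : X) : Decidable ((ofNatDist d).rel a b c) :=
  inferInstanceAs (Decidable (d a c = d a b + d b c))

theorem completeThree_rel_iff_eq (a b c : Fin 3) : completeThree.rel a b c ↔ a = b ∨ b = c := by
  rw [completeThree_rel_iff]
  revert a b c
  decide

/-- The four relations of a square leave no freedom: in each of its four triples a middle point is
prescribed, and a triple of distinct points has only one. So the square carries exactly the
betweenness of the four-cycle. -/
theorem isRegular_iff {B : BetweennessStructure X} (hB : B.IsAlmostMetrizable) :
    B.IsRegular ↔ ∀ a b c d, ¬ B.IsSquare a b c d := by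
  constructor
  · rintro hreg a b c d ⟨ab, ac, ad, bc, bd, cd, abc, bcd, cda, dab⟩
    let f : Fin 4 → X := ![a, b, c, d]
    have hf : Function.Injective f := by
      intro i j h
      fin_cases i <;> fin_cases j <;> simp_all [f, eq_comm]
    refine hreg ⟨Set.range f, (Equiv.ofInjective f hf).symm, ?_⟩
    have key : ∀ i j k, B.rel (f i) (f j) (f k) ↔ cycleFour.rel i j k := by
      intro i j k
      rw [cycleFour_rel_iff]
      have h1 := hB.not_left abc ab
      have h2 := hB.not_right abc bc
      have h3 := hB.not_left bcd bc
      have h4 := hB.not_right bcd cd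
      have h5 := hB.not_left cda cd
      have h6 := hB.not_right cda ad.symm
      have h7 := hB.not_left dab ad.symm
      have h8 := hB.not_right dab ab
      have h1' := mt (hB.symm _ _ _) h1
      have h2' := mt (hB.symm _ _ _) h2
      have h3' := mt (hB.symm _ _ _) h3
      have h4' := mt (hB.symm _ _ _) h4
      have h5' := mt (hB.symm _ _ _) h5
      have h6' := mt (hB.symm _ _ _) h6
      have h7' := mt (hB.symm _ _ _) h7
      have h8' := mt (hB.symm _ _ _) h8
      have ba := ab.symm
      have ca := ac.symm
      have da := ad.symm
      have cb := bc.symm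
      have db := bd.symm
      have dc := cd.symm
      have abc' := hB.symm _ _ _ abc
      have bcd' := hB.symm _ _ _ bcd
      have cda' := hB.symm _ _ _ cda
      have dab' := hB.symm _ _ _ dab
      fin_cases i <;> fin_cases j <;> fin_cases k <;>
        simp [f, ofNatDist, hB.left_self, hB.right_self, hB.rel_self_iff, *]
    rintro ⟨_, i, rfl⟩ ⟨_, j, rfl⟩ ⟨_, k, rfl⟩
    have e : ∀ i, (Equiv.ofInjective f hf).symm ⟨f i, i, rfl⟩ = i := fun i =>
      (Equiv.ofInjective f hf).symm_apply_apply i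
    rw [e, e, e]
    exact key i j k
  · rintro h ⟨S, e, he⟩
    have r : ∀ i j k, (ofNatDist fun a b : Fin 4 =>
        if a = b then 0 else if a + 2 = b then 2 else 1).rel i j k →
        B.rel (e.symm i) (e.symm j) (e.symm k) := by
      intro i j k hr
      refine (he (e.symm i) (e.symm j) (e.symm k)).2 ?_
      simp only [Equiv.apply_symm_apply]
      exact (cycleFour_rel_iff _ _ _).2 hr
    have ne : ∀ i j : Fin 4, i ≠ j → (e.symm i : X) ≠ e.symm j := fun i j hij h =>
      hij (e.symm.injective (Subtype.ext h))
    exact h (e.symm 0) (e.symm 1) (e.symm 2) (e.symm 3)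
      ⟨ne _ _ (by decide), ne _ _ (by decide), ne _ _ (by decide), ne _ _ (by decide),
        ne _ _ (by decide), ne _ _ (by decide), r _ _ _ (by decide), r _ _ _ (by decide),
        r _ _ _ (by decide), r _ _ _ (by decide)⟩

/-! ### Invariance under isomorphism -/

theorem IsIsomorphic.symm {B : BetweennessStructure X} {C : BetweennessStructure Y}
    (h : B.IsIsomorphic C) : C.IsIsomorphic B := by
  obtain ⟨e, he⟩ := h
  exact ⟨e.symm, fun x y z => by rw [he]; simp⟩

theorem IsIsomorphic.isAlmostMetrizable {B : BetweennessStructure X} {C : BetweennessStructure Y}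
    (h : B.IsIsomorphic C) (hB : B.IsAlmostMetrizable) : C.IsAlmostMetrizable := by
  obtain ⟨e, he⟩ := h.symm
  exact ⟨fun x z => (he _ _ _).2 (hB.left_self _ _),
    fun x y z h => (he _ _ _).2 (hB.symm _ _ _ ((he _ _ _).1 h)),
    fun x y z h h' => e.injective (hB.eq_of_rel _ _ _ ((he _ _ _).1 h) ((he _ _ _).1 h')),
    fun x y z w h h' => by
      rw [he, he]
      exact hB.four_relations _ _ _ _ ((he _ _ _).1 h) ((he _ _ _).1 h')⟩

theorem IsIsomorphic.isRegular {B : BetweennessStructure X} {C : BetweennessStructure Y}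
    (h : B.IsIsomorphic C) (hB : B.IsAlmostMetrizable) (hr : B.IsRegular) : C.IsRegular := by
  rw [isRegular_iff (h.isAlmostMetrizable hB)]
  rw [isRegular_iff hB] at hr
  obtain ⟨e, he⟩ := h.symm
  rintro a b c d ⟨ab, ac, ad, bc, bd, cd, abc, bcd, cda, dab⟩
  exact hr (e a) (e b) (e c) (e d) ⟨e.injective.ne ab, e.injective.ne ac, e.injective.ne ad,
    e.injective.ne bc, e.injective.ne bd, e.injective.ne cd, (he _ _ _).1 abc, (he _ _ _).1 bcd,
    (he _ _ _).1 cda, (he _ _ _).1 dab⟩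

theorem IsCollinear.map {B : BetweennessStructure X} {C : BetweennessStructure Y} (e : X ≃ Y)
    (he : ∀ x y z, B.rel x y z ↔ C.rel (e x) (e y) (e z)) {T : Finset X} (h : B.IsCollinear T) :
    C.IsCollinear (T.map e.toEmbedding) := by
  obtain ⟨x, y, z, hT, h⟩ := h
  exact ⟨e x, e y, e z, by simp [hT, Set.image_insert_eq], (he _ _ _).1 h⟩

theorem IsIsomorphic.coSize_eq {B : BetweennessStructure X} {C : BetweennessStructure Y}
    (h : B.IsIsomorphic C) : B.coSize = C.coSize := by
  obtain ⟨e, he⟩ := h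
  have he' : ∀ x y z, C.rel x y z ↔ B.rel (e.symm x) (e.symm y) (e.symm z) := fun x y z => by
    rw [he]; simp
  refine Set.ncard_congr (fun T _ => T.map e.toEmbedding) ?_ ?_ ?_
  · rintro T ⟨h1, h2⟩
    refine ⟨by simpa using h1, fun h3 => h2 ?_⟩
    have := h3.map e.symm he'
    rwa [Finset.map_map, ← Equiv.trans_toEmbedding, Equiv.self_trans_symm,
      Equiv.refl_toEmbedding, Finset.map_refl] at this
  · intro T T' _ _ h
    exact Finset.map_injective _ h
  · rintro T ⟨h1, h2⟩
    have e' : (T.map e.symm.toEmbedding).map e.toEmbedding = T := by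
      rw [Finset.map_map, ← Equiv.trans_toEmbedding, Equiv.symm_trans_self,
        Equiv.refl_toEmbedding, Finset.map_refl]
    refine ⟨T.map e.symm.toEmbedding, ⟨by simpa using h1, fun h3 => h2 ?_⟩, e'⟩
    have := h3.map e he
    rwa [e'] at this

end BetweennessStructure

/-! ### Triple systems -/

section TripleSystem

variable {X : Type u} [DecidableEq X]

/-- A system of triples in which no set of five points contains exactly one triple, or exactly two
triples that share just one point. -/
structure IsSparseFree (H : Finset (Finset X)) : Prop where
  card_eq : ∀ T ∈ H, T.card = 3
  ne_one : ∀ S : Finset X, S.card = 5 → ∀ T, H.filter (· ⊆ S) ≠ {T}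
  ne_pair : ∀ S : Finset X, S.card = 5 → ∀ T T', H.filter (· ⊆ S) = {T, T'} →
    (T ∩ T').card ≠ 1

variable {H : Finset (Finset X)}

/-- The deletion step of both inductions: removing `p` keeps `T'` and loses `T`, so some triple
survives while the count drops. -/
theorem filter_subset_erase_add_one_le {S T T' : Finset X} {p : X} (hT : T ∈ H.filter (· ⊆ S))
    (hT' : T' ∈ H.filter (· ⊆ S)) (hp : p ∈ T) (hp' : p ∉ T') :
    (H.filter (· ⊆ S.erase p)).Nonempty ∧
      H.filter (· ⊆ S.erase p) ⊆ (H.filter (· ⊆ S)).erase T := by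
  simp only [Finset.mem_filter] at hT hT'
  refine ⟨⟨T', Finset.mem_filter.2 ⟨hT'.1, fun x hx => Finset.mem_erase.2 ⟨?_, hT'.2 hx⟩⟩⟩, ?_⟩
  · rintro rfl; exact hp' hx
  · intro U hU
    simp only [Finset.mem_filter, Finset.mem_erase] at hU ⊢
    refine ⟨?_, hU.1, hU.2.trans (Finset.erase_subset _ _)⟩
    rintro rfl
    exact (Finset.mem_erase.1 (hU.2 hp)).1 rfl

theorem exists_mem_not_mem_of_card_eq {T T' : Finset X} (h : T.card = T'.card) (hne : T ≠ T') :
    ∃ p ∈ T, p ∉ T' := by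
  by_contra! hsub
  exact hne (Finset.eq_of_subset_of_card_le hsub h.ge)

/-- A lone triple in `S` would still be alone in any five-point set between it and `S`. -/
theorem IsSparseFree.two_le_card (hH : IsSparseFree H) {S : Finset X} (hS : 5 ≤ S.card)
    (hne : (H.filter (· ⊆ S)).Nonempty) : 2 ≤ (H.filter (· ⊆ S)).card := by
  by_contra! hlt
  have h1 : (H.filter (· ⊆ S)).card = 1 := by have := hne.card_pos; omega
  obtain ⟨T, hT⟩ := Finset.card_eq_one.1 h1
  have hmem : T ∈ H.filter (· ⊆ S) := by simp [hT]
  have hmem' := Finset.mem_filter.1 hmem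
  obtain ⟨S', hTS, hS', hcard⟩ := Finset.exists_subsuperset_card_eq (n := 5) hmem'.2
    (by rw [hH.card_eq T hmem'.1]; omega) hS
  refine hH.ne_one S' hcard T (Finset.eq_singleton_iff_unique_mem.2
    ⟨Finset.mem_filter.2 ⟨hmem'.1, hTS⟩, fun U hU => ?_⟩)
  have hU' := Finset.mem_filter.1 hU
  have : U ∈ H.filter (· ⊆ S) := Finset.mem_filter.2 ⟨hU'.1, hU'.2.trans hS'⟩
  simpa [hT] using this

/-- From five points on there are two different triples. Deleting a point of one outside the other
lowers the number of points by one and the number of triples by at least one. -/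
theorem IsSparseFree.le_card (hH : IsSparseFree H) (S : Finset X)
    (hne : (H.filter (· ⊆ S)).Nonempty) : S.card - 3 ≤ (H.filter (· ⊆ S)).card := by
  induction S using Finset.strongInduction with
  | H S ih =>
    rcases le_or_gt S.card 4 with h4 | h5
    · have := hne.card_pos; omega
    obtain ⟨T, hT, T', hT', hTT⟩ := Finset.one_lt_card.1 (hH.two_le_card h5 hne)
    obtain ⟨p, hp, hp'⟩ := exists_mem_not_mem_of_card_eq
      ((hH.card_eq _ (Finset.mem_filter.1 hT).1).trans
        (hH.card_eq _ (Finset.mem_filter.1 hT').1).symm) hTT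
    obtain ⟨h1, h2⟩ := filter_subset_erase_add_one_le hT hT' hp hp'
    have hpS := (Finset.mem_filter.1 hT).2 hp
    have h3 := ih _ (Finset.erase_ssubset hpS) h1
    have h4 := Finset.card_le_card h2
    rw [Finset.card_erase_of_mem hT] at h4
    rw [Finset.card_erase_of_mem hpS] at h3
    omega

/-- In the extremal case all triples share two points. -/
theorem IsSparseFree.exists_common_pair (hH : IsSparseFree H) (S : Finset X) (hS : 4 ≤ S.card)
    (hcard : (H.filter (· ⊆ S)).card = S.card - 3) :
    ∃ y z, y ≠ z ∧ ∀ T ∈ H.filter (· ⊆ S), y ∈ T ∧ z ∈ T := by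
  induction S using Finset.strongInduction with
  | H S ih =>
    obtain h4 | h5 | h6 : S.card = 4 ∨ S.card = 5 ∨ 6 ≤ S.card := by omega
    · rw [h4] at hcard
      obtain ⟨T, hT⟩ := Finset.card_eq_one.1 hcard
      have hmem : T ∈ H.filter (· ⊆ S) := by simp [hT]
      have hT3 := hH.card_eq T (Finset.mem_filter.1 hmem).1
      obtain ⟨y, hy, z, hz, hyz⟩ := Finset.one_lt_card.1 (show 1 < T.card by omega)
      refine ⟨y, z, hyz, fun U hU => ?_⟩
      rw [hT, Finset.mem_singleton] at hU
      exact hU ▸ ⟨hy, hz⟩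
    · rw [h5] at hcard
      obtain ⟨T, T', hTT, hT⟩ := Finset.card_eq_two.1 hcard
      have hmem : T ∈ H.filter (· ⊆ S) := by simp [hT]
      have hmem' : T' ∈ H.filter (· ⊆ S) := by simp [hT]
      rw [Finset.mem_filter] at hmem hmem'
      -- Two triples in five points meet in at least `3 + 3 - 5 = 1` point; as one is excluded, they
      -- share two.
      have h1 := hH.ne_pair S h5 T T' hT
      have h2 := Finset.card_union_add_card_inter T T'
      have h3 := Finset.card_le_card (Finset.union_subset hmem.2 hmem'.2)
      rw [hH.card_eq _ hmem.1, hH.card_eq _ hmem'.1] at h2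
      obtain ⟨y, hy, z, hz, hyz⟩ := Finset.one_lt_card.1 (show 1 < (T ∩ T').card by omega)
      rw [Finset.mem_inter] at hy hz
      refine ⟨y, z, hyz, fun U hU => ?_⟩
      rw [hT, Finset.mem_insert, Finset.mem_singleton] at hU
      rcases hU with rfl | rfl
      · exact ⟨hy.1, hz.1⟩
      · exact ⟨hy.2, hz.2⟩
    · obtain ⟨T, hT, T', hT', hTT⟩ := Finset.one_lt_card.1
        (show 1 < (H.filter (· ⊆ S)).card by omega)
      obtain ⟨p, hp, hp'⟩ := exists_mem_not_mem_of_card_eq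
        ((hH.card_eq _ (Finset.mem_filter.1 hT).1).trans
          (hH.card_eq _ (Finset.mem_filter.1 hT').1).symm) hTT
      obtain ⟨h1, h2⟩ := filter_subset_erase_add_one_le hT hT' hp hp'
      have hpS := (Finset.mem_filter.1 hT).2 hp
      have h3 := hH.le_card _ h1
      have h4 := Finset.card_le_card h2
      rw [Finset.card_erase_of_mem hT] at h4
      rw [Finset.card_erase_of_mem hpS] at h3
      have hcp : (S.erase p).card = S.card - 1 := Finset.card_erase_of_mem hpS
      -- Equality is inherited: the lower bound for `S.erase p` leaves room for the loss of `T`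
      -- only.
      have h5 : (H.filter (· ⊆ S.erase p)).card = (S.erase p).card - 3 := by omega
      have heq : H.filter (· ⊆ S.erase p) = (H.filter (· ⊆ S)).erase T :=
        Finset.eq_of_subset_of_card_le h2 (by rw [Finset.card_erase_of_mem hT]; omega)
      obtain ⟨y, z, hyz, hall⟩ := ih _ (Finset.erase_ssubset hpS) (by omega) h5
      -- If `T` missed a point `w` common to all other triples, then deleting `w` would leave `T`
      -- alone on at least five points, against the bound. This is where six points are needed.
      have claim : ∀ w, (∀ U ∈ H.filter (· ⊆ S.erase p), w ∈ U) → w ∈ T := by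
        intro w hw
        by_contra hwT
        have hT'' : T' ∈ H.filter (· ⊆ S.erase p) := by
          rw [heq]; exact Finset.mem_erase.2 ⟨hTT.symm, hT'⟩
        have hwT' := hw T' hT''
        have hwS := (Finset.mem_filter.1 hT').2 hwT'
        obtain ⟨h6, -⟩ := filter_subset_erase_add_one_le hT' hT hwT' hwT
        have h7 := hH.le_card _ h6
        have h8 : H.filter (· ⊆ S.erase w) ⊆ {T} := by
          intro U hU
          rw [Finset.mem_filter] at hU
          by_contra hne
          rw [Finset.mem_singleton] at hne
          have : U ∈ H.filter (· ⊆ S.erase p) := by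
            rw [heq, Finset.mem_erase, Finset.mem_filter]
            exact ⟨hne, hU.1, hU.2.trans (Finset.erase_subset _ _)⟩
          exact (Finset.mem_erase.1 (hU.2 (hw U this))).1 rfl
        have h9 := Finset.card_le_card h8
        rw [Finset.card_erase_of_mem hwS] at h7
        rw [Finset.card_singleton] at h9
        omega
      refine ⟨y, z, hyz, fun U hU => ?_⟩
      by_cases hUT : U = T
      · subst hUT
        exact ⟨claim y fun U hU => (hall U hU).1, claim z fun U hU => (hall U hU).2⟩
      · exact hall U (by rw [heq]; exact Finset.mem_erase.2 ⟨hUT, hU⟩)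

end TripleSystem

/-! ### Triangles among four and five points -/

namespace BetweennessStructure

variable {X : Type u} {B : BetweennessStructure X}

/-- If `x` were between `s` and one of `y`, `z`, it would be between `y` and `z`. If `s` separated
`x` from one of them while the other lay between `s` and `x`, transitivity would make `x`, `y`, `z`
collinear. Only the two symmetric positions remain. -/
theorem of_rel_mid (hB : B.IsAlmostMetrizable) {x y z s : X} (hxy : x ≠ y) (hxz : x ≠ z)
    (ht : ¬ B.Collinear y z x)
    (hy : B.Collinear s y x) (hz : B.Collinear s z x) (h : B.rel y s z) :
    (B.rel y s x ∧ B.rel z s x) ∨ (B.rel s y x ∧ B.rel s z x) := by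
  have h1 := hB.symm
  have h2 := hB.eq_of_rel
  have h3 := hB.four_relations
  unfold Collinear at *
  clear hB
  grind

/-- By transitivity, every other position of `x` on the two lines through `s` makes `y`, `z`, `x`
collinear. -/
theorem of_rel_left (hB : B.IsAlmostMetrizable) {x y z s : X} (hsy : s ≠ y)
    (ht : ¬ B.Collinear y z x)
    (hy : B.Collinear s y x) (hz : B.Collinear s z x) (h : B.rel s y z) :
    B.rel s x z ∧ B.rel x s y := by
  have h1 := hB.symm
  have h2 := hB.eq_of_rel
  have h3 := hB.four_relations
  unfold Collinear at *
  clear hB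
  grind

/-- The fourth point `d` is either a centre, between all three pairs of vertices, or between just
one pair, whose two members then lie between `d` and the third vertex. -/
theorem four_cases (hB : B.IsAlmostMetrizable) {a b c d : X} (hab : a ≠ b) (hac : a ≠ c)
    (had : a ≠ d) (hbc : b ≠ c) (hbd : b ≠ d) (hcd : c ≠ d) (ht : ¬ B.Collinear a b c)
    (h1 : B.Collinear a b d) (h2 : B.Collinear a c d) (h3 : B.Collinear b c d) :
    (B.rel a d b ∧ B.rel a d c ∧ B.rel b d c) ∨ (B.rel d a c ∧ B.rel d b c ∧ B.rel a d b) ∨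
    (B.rel d a b ∧ B.rel d c b ∧ B.rel a d c) ∨ (B.rel d b a ∧ B.rel d c a ∧ B.rel b d c) := by
  have e1 := hB.symm
  have e2 := hB.eq_of_rel
  have e3 := hB.four_relations
  unfold Collinear at *
  clear hB
  grind

/-- Sixteen combinations of the positions of `d` and `e` are refuted. For instance, let both be
centres. A vertex between `d` and `e` leads to a square or a contradiction; otherwise two of the
three vertices see `d` and `e` in the same order, which is impossible since each of `d`, `e` lies
between those vertices. -/
theorem not_one_triangle (hB : B.IsAlmostMetrizable) (hreg : ∀ a b c d, ¬ B.IsSquare a b c d)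
    {a b c d e : X} (hab : a ≠ b) (hac : a ≠ c) (had : a ≠ d) (hae : a ≠ e) (hbc : b ≠ c)
    (hbd : b ≠ d) (hbe : b ≠ e) (hcd : c ≠ d) (hce : c ≠ e) (hde : d ≠ e)
    (abc : ¬ B.Collinear a b c) (abd : B.Collinear a b d) (abe : B.Collinear a b e)
    (acd : B.Collinear a c d) (ace : B.Collinear a c e) (ade : B.Collinear a d e)
    (bcd : B.Collinear b c d) (bce : B.Collinear b c e) (bde : B.Collinear b d e)
    (cde : B.Collinear c d e) : False := by
  have d4 := four_cases hB hab hac had hbc hbd hcd abc abd acd bcd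
  have e4 := four_cases hB hab hac hae hbc hbe hce abc abe ace bce
  clear abd abe acd ace bcd bce
  have e1 := hB.symm
  have e2 := hB.eq_of_rel
  have e3 := hB.four_relations
  unfold Collinear at *
  clear hB
  have e5 : ∀ a b c d, B.rel a b c → B.rel b c d → B.rel c d a → B.rel d a b →
      a = b ∨ a = c ∨ a = d ∨ b = c ∨ b = d ∨ c = d := by
    intro a b c d h1 h2 h3 h4
    by_contra! hne
    obtain ⟨n1, n2, n3, n4, n5, n6⟩ := hne
    exact hreg a b c d ⟨n1, n2, n3, n4, n5, n6, h1, h2, h3, h4⟩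
  clear hreg
  rcases d4 with h | h | h | h <;> rcases e4 with h' | h' | h' | h' <;> grind

/-- The sixteen positions relative to `a b c` are the same as for a single triangle; only the role
of `a d e` changes. -/
theorem not_two_triangles (hB : B.IsAlmostMetrizable) (hreg : ∀ a b c d, ¬ B.IsSquare a b c d)
    {a b c d e : X} (hab : a ≠ b) (hac : a ≠ c) (had : a ≠ d) (hae : a ≠ e) (hbc : b ≠ c)
    (hbd : b ≠ d) (hbe : b ≠ e) (hcd : c ≠ d) (hce : c ≠ e) (hde : d ≠ e)
    (abc : ¬ B.Collinear a b c) (abd : B.Collinear a b d) (abe : B.Collinear a b e)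
    (acd : B.Collinear a c d) (ace : B.Collinear a c e) (ade : ¬ B.Collinear a d e)
    (bcd : B.Collinear b c d) (bce : B.Collinear b c e) (bde : B.Collinear b d e)
    (cde : B.Collinear c d e) : False := by
  have d4 := four_cases hB hab hac had hbc hbd hcd abc abd acd bcd
  have e4 := four_cases hB hab hac hae hbc hbe hce abc abe ace bce
  clear abd abe acd ace bcd bce
  have e1 := hB.symm
  have e2 := hB.eq_of_rel
  have e3 := hB.four_relations
  unfold Collinear at *
  clear hB
  have e5 : ∀ a b c d, B.rel a b c → B.rel b c d → B.rel c d a → B.rel d a b →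
      a = b ∨ a = c ∨ a = d ∨ b = c ∨ b = d ∨ c = d := by
    intro a b c d h1 h2 h3 h4
    by_contra! hne
    obtain ⟨n1, n2, n3, n4, n5, n6⟩ := hne
    exact hreg a b c d ⟨n1, n2, n3, n4, n5, n6, h1, h2, h3, h4⟩
  clear hreg
  rcases d4 with h | h | h | h <;> rcases e4 with h' | h' | h' | h' <;> grind

theorem mem_triangles_iff [DecidableEq X] (hB : B.IsAlmostMetrizable) {a b c : X} (hab : a ≠ b)
    (hac : a ≠ c) (hbc : b ≠ c) : {a, b, c} ∈ B.triangles ↔ ¬ B.Collinear a b c := by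
  rw [triangles, Set.mem_ofPred_eq, hB.isCollinear_iff hab hac hbc,
    and_iff_right (Finset.card_eq_three.2 ⟨a, b, c, hab, hac, hbc, rfl⟩)]

/-- The triangles of a regular betweenness structure form a sparse-free system of triples. -/
theorem isSparseFree_of_isRegular [DecidableEq X] (hB : B.IsAlmostMetrizable)
    (hreg : B.IsRegular) {H : Finset (Finset X)} (hH : ∀ T, T ∈ H ↔ T ∈ B.triangles) :
    IsSparseFree H := by
  rw [isRegular_iff hB] at hreg
  -- Every triple of `S` that is not listed in `F` is collinear; this supplies all the collinearity
  -- hypotheses of the five-point lemmas.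
  have col : ∀ S F, H.filter (· ⊆ S) = F → ∀ a ∈ S, ∀ b ∈ S, ∀ c ∈ S, a ≠ b → a ≠ c → b ≠ c →
      {a, b, c} ∉ F → B.Collinear a b c := by
    rintro S _ rfl a ha b hb c hc hab hac hbc h
    by_contra hn
    refine h (Finset.mem_filter.2 ⟨(hH _).2 ((mem_triangles_iff hB hab hac hbc).2 hn), ?_⟩)
    intro x hx
    simp only [Finset.mem_insert, Finset.mem_singleton] at hx
    rcases hx with rfl | rfl | rfl <;> assumption
  refine ⟨fun T hT => ((hH T).1 hT).1, fun S hS T hT => ?_, fun S hS T T' hT h1 => ?_⟩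
  · have hTm : T ∈ H.filter (· ⊆ S) := by simp [hT]
    rw [Finset.mem_filter, hH] at hTm
    obtain ⟨hTt, hTS⟩ := hTm
    have hcard := Finset.card_sdiff_of_subset hTS
    rw [hTt.1, hS] at hcard
    obtain ⟨d, e, hde, he⟩ := Finset.card_eq_two.1 hcard
    have hd : d ∈ S \ T := by simp [he]
    have he' : e ∈ S \ T := by simp [he]
    obtain ⟨a, b, c, hab, hac, hbc, rfl⟩ := Finset.card_eq_three.1 hTt.1
    rw [mem_triangles_iff hB hab hac hbc] at hTt
    simp only [Finset.mem_sdiff, Finset.mem_insert, Finset.mem_singleton, not_or] at hd he'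
    obtain ⟨dS, da, db, dc⟩ := hd
    obtain ⟨eS, ea, eb, ec⟩ := he'
    have aS : a ∈ S := hTS (by simp)
    have bS : b ∈ S := hTS (by simp)
    have cS : c ∈ S := hTS (by simp)
    have key := col S _ hT
    have nd : ∀ F : Finset X, d ∈ F → F ∉ ({{a, b, c}} : Finset (Finset X)) := by
      intro F hF h
      rw [Finset.mem_singleton] at h
      rw [h] at hF
      simp [da, db, dc] at hF
    have ne : ∀ F : Finset X, e ∈ F → F ∉ ({{a, b, c}} : Finset (Finset X)) := by
      intro F hF h
      rw [Finset.mem_singleton] at h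
      rw [h] at hF
      simp [ea, eb, ec] at hF
    exact not_one_triangle hB hreg hab hac (Ne.symm da) (Ne.symm ea) hbc (Ne.symm db)
      (Ne.symm eb) (Ne.symm dc) (Ne.symm ec) hde hTt
      (key a aS b bS d dS hab (Ne.symm da) (Ne.symm db) (nd _ (by simp)))
      (key a aS b bS e eS hab (Ne.symm ea) (Ne.symm eb) (ne _ (by simp)))
      (key a aS c cS d dS hac (Ne.symm da) (Ne.symm dc) (nd _ (by simp)))
      (key a aS c cS e eS hac (Ne.symm ea) (Ne.symm ec) (ne _ (by simp)))
      (key a aS d dS e eS (Ne.symm da) (Ne.symm ea) hde (ne _ (by simp)))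
      (key b bS c cS d dS hbc (Ne.symm db) (Ne.symm dc) (nd _ (by simp)))
      (key b bS c cS e eS hbc (Ne.symm eb) (Ne.symm ec) (ne _ (by simp)))
      (key b bS d dS e eS (Ne.symm db) (Ne.symm eb) hde (ne _ (by simp)))
      (key c cS d dS e eS (Ne.symm dc) (Ne.symm ec) hde (ne _ (by simp)))
  · have hTm : T ∈ H.filter (· ⊆ S) := by simp [hT]
    have hTm' : T' ∈ H.filter (· ⊆ S) := by simp [hT]
    rw [Finset.mem_filter, hH] at hTm hTm'
    obtain ⟨hTt, hTS⟩ := hTm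
    obtain ⟨hTt', hTS'⟩ := hTm'
    obtain ⟨a, ha⟩ := Finset.card_eq_one.1 h1
    have hmem : ∀ x, x ∈ T ∧ x ∈ T' ↔ x = a := fun x => by
      rw [← Finset.mem_inter, ha, Finset.mem_singleton]
    obtain ⟨aT, aT'⟩ := (hmem a).2 rfl
    have two : ∀ U : Finset X, U.card = 3 → a ∈ U → ∃ b c, b ≠ c ∧ a ≠ b ∧ a ≠ c ∧ U = {a, b, c} := by
      intro U hU haU
      have := Finset.card_erase_of_mem haU
      rw [hU] at this
      obtain ⟨b, c, hbc, h⟩ := Finset.card_eq_two.1 this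
      have hb : b ∈ U.erase a := by simp [h]
      have hc : c ∈ U.erase a := by simp [h]
      refine ⟨b, c, hbc, (Finset.ne_of_mem_erase hb).symm, (Finset.ne_of_mem_erase hc).symm, ?_⟩
      rw [← h, Finset.insert_erase haU]
    obtain ⟨b, c, hbc, hab, hac, rfl⟩ := two T hTt.1 aT
    obtain ⟨d, e, hde, had, hae, rfl⟩ := two T' hTt'.1 aT'
    rw [mem_triangles_iff hB hab hac hbc] at hTt
    rw [mem_triangles_iff hB had hae hde] at hTt'
    have mb := hmem b
    have mc := hmem c
    simp only [Finset.mem_insert, Finset.mem_singleton, true_or, or_true, true_and, hab.symm,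
      hac.symm, false_or, iff_false, not_or] at mb mc
    obtain ⟨hbd, hbe⟩ := mb
    obtain ⟨hcd, hce⟩ := mc
    have aS : a ∈ S := hTS (by simp)
    have bS : b ∈ S := hTS (by simp)
    have cS : c ∈ S := hTS (by simp)
    have dS : d ∈ S := hTS' (by simp)
    have eS : e ∈ S := hTS' (by simp)
    have key := col S _ hT
    have nn : ∀ F : Finset X, b ∈ F ∨ c ∈ F → d ∈ F ∨ e ∈ F →
        F ∉ ({{a, b, c}, {a, d, e}} : Finset (Finset X)) := by
      intro F hF hF' h
      rw [Finset.mem_insert, Finset.mem_singleton] at h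
      rcases h with rfl | rfl
      · simp [had.symm, hae.symm, Ne.symm hbd, Ne.symm hbe, Ne.symm hcd, Ne.symm hce] at hF'
      · simp [hab.symm, hac.symm, hbd, hbe, hcd, hce] at hF
    exact not_two_triangles hB hreg hab hac had hae hbc hbd hbe hcd hce hde hTt
      (key a aS b bS d dS hab had hbd (nn _ (by simp) (by simp)))
      (key a aS b bS e eS hab hae hbe (nn _ (by simp) (by simp)))
      (key a aS c cS d dS hac had hcd (nn _ (by simp) (by simp)))
      (key a aS c cS e eS hac hae hce (nn _ (by simp) (by simp))) hTt'
      (key b bS c cS d dS hbc hbd hcd (nn _ (by simp) (by simp)))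
      (key b bS c cS e eS hbc hbe hce (nn _ (by simp) (by simp)))
      (key b bS d dS e eS hbd hbe hde (nn _ (by simp) (by simp)))
      (key c cS d dS e eS hcd hce hde (nn _ (by simp) (by simp)))

end BetweennessStructure

/-! ### The three families as twisted lines -/

/-- With natural weights all side conditions become statements of linear arithmetic over `ℕ`. -/
theorem WeightedGraph.ofEdges_natCast_dist_eq {V : Type u} (f : V → V → ℕ) (d : V → V → ℕ)
    (hself : ∀ a, d a a = 0) (hsymm : ∀ a b, d a b = d b a)
    (hle : ∀ a b c, 0 < f a c → d a b ≤ f a c + d c b ∧ d c b ≤ f a c + d a b)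
    (hstep : ∀ a b, a ≠ b → ∃ c, (a ≠ c ∧ 0 < max (f a c) (f c a) ∧
        d a b = max (f a c) (f c a) + d c b) ∨
      (b ≠ c ∧ 0 < max (f b c) (f c b) ∧ d b a = max (f b c) (f c b) + d c a)) (a b : V) :
    (ofEdges fun a b => (f a b : ℝ)).dist a b = d a b := by
  refine ofEdges_dist_eq _ d hself hsymm (fun a b c h => ?_) (fun a b h => ?_) a b
  · have := hle a b c (by exact_mod_cast h)
    exact_mod_cast this
  · obtain ⟨c, ⟨h1, h2, h3⟩ | ⟨h1, h2, h3⟩⟩ := hstep a b h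
    · refine ⟨c, .inl ⟨⟨h1, by beta_reduce; exact_mod_cast h2⟩, ?_⟩⟩
      rw [h3]
      simp [ofEdges]
    · refine ⟨c, .inr ⟨⟨h1, by beta_reduce; exact_mod_cast h2⟩, ?_⟩⟩
      rw [h3]
      simp [ofEdges]

open Classical in
/-- The distance on a line, with the distance of `y` and `z` replaced by `c`. -/
noncomputable def twistDist {X : Type u} (p : X → ℤ) (y z : X) (c : ℕ) (a b : X) : ℕ :=
  if (a = y ∧ b = z) ∨ (a = z ∧ b = y) then c else (p a - p b).natAbs

section twistDist

variable {X : Type u} {p : X → ℤ} {y z : X} {c : ℕ}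

theorem twistDist_self (hyz : y ≠ z) (a : X) : twistDist p y z c a a = 0 := by
  unfold twistDist
  rw [if_neg]
  · simp
  · rintro (⟨rfl, h⟩ | ⟨rfl, h⟩)
    · exact hyz h
    · exact hyz h.symm

theorem twistDist_comm (a b : X) : twistDist p y z c a b = twistDist p y z c b a := by
  unfold twistDist
  congr 1
  · exact propext (by tauto)
  · omega

theorem twistDist_left_right : twistDist p y z c y z = c := by simp [twistDist]

theorem twistDist_right_left : twistDist p y z c z y = c := by simp [twistDist]

theorem twistDist_of_ne_right {a b : X} (ha : a ≠ z) (hb : b ≠ z) :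
    twistDist p y z c a b = (p a - p b).natAbs := by simp [twistDist, ha, hb]

theorem twistDist_of_ne_left {a b : X} (ha : a ≠ y) (hb : b ≠ y) :
    twistDist p y z c a b = (p a - p b).natAbs := by simp [twistDist, ha, hb]

end twistDist

section Positions

variable {n : ℕ}

/-- The positions of the vertices of `graphQ3 n` on a line. -/
def positionQ (n : ℕ) : StarVertex n → ℤ
  | .x k => (n : ℤ) - 3 - k.val
  | .y => (n : ℤ) - 2
  | .z => (n : ℤ) - 2

/-- The positions of the vertices of `graphR3 n i` on a line. -/
def positionR (n i : ℕ) : StarVertex n → ℤ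
  | .x k => if k.val + 1 ≤ i then k.val else k.val + 2
  | .y => i
  | .z => i

/-- The positions of the vertices of `graphS3 n` on a line. -/
def positionS (n : ℕ) : StarVertex n → ℤ
  | .x k => k.val + 1
  | .y => 0
  | .z => n

open StarVertex

theorem graphQ3_dist (hn : 4 ≤ n) (a b : StarVertex n) :
    (graphQ3 n).dist a b = twistDist (positionQ n) y z 2 a b := by
  have hf : graphQ3 n = WeightedGraph.ofEdges fun a b => ((match a, b with
      | x j, x k => if j.val + 1 = k.val then 1 else 0
      | y, x j => if j.val + 1 = 1 then 1 else 0
      | z, x j => if j.val + 1 = 1 then 1 else 0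
      | _, _ => 0 : ℕ) : ℝ) := by
    unfold graphQ3
    congr 1
    funext a b
    cases a <;> cases b <;> simp
  rw [hf]
  refine WeightedGraph.ofEdges_natCast_dist_eq _ _ (twistDist_self (by simp)) twistDist_comm
    ?_ ?_ a b
  · rintro (j | _ | _) (k | _ | _) (l | _ | _) <;>
      simp [twistDist, positionQ] <;> (try split_ifs) <;> omega
  · have step : ∀ j k : Fin (n - 2), j.val < k.val → ∃ l : Fin (n - 2), l.val = j.val + 1 :=
      fun j k h => ⟨⟨j + 1, by omega⟩, rfl⟩
    obtain ⟨o, ho⟩ : ∃ l : Fin (n - 2), l.val = 0 := ⟨⟨0, by omega⟩, rfl⟩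
    rintro (j | _ | _) (k | _ | _) h
    · obtain hlt | hlt : j.val < k.val ∨ k.val < j.val := by
        have : j.val ≠ k.val := fun e => h (by rw [Fin.ext e])
        omega
      · obtain ⟨l, hl⟩ := step j k hlt
        refine ⟨x l, .inl ?_⟩
        simp [twistDist, positionQ, Fin.ext_iff, hl]; split_ifs <;> omega
      · obtain ⟨l, hl⟩ := step k j hlt
        refine ⟨x l, .inr ?_⟩
        simp [twistDist, positionQ, Fin.ext_iff, hl]; split_ifs <;> omega
    · refine ⟨x o, .inr ?_⟩
      simp [twistDist, positionQ, ho]; omega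
    · refine ⟨x o, .inr ?_⟩
      simp [twistDist, positionQ, ho]; omega
    · refine ⟨x o, .inl ?_⟩
      simp [twistDist, positionQ, ho]; omega
    · exact absurd rfl h
    · refine ⟨x o, .inl ?_⟩
      simp [twistDist, positionQ, ho]
    · refine ⟨x o, .inl ?_⟩
      simp [twistDist, positionQ, ho]; omega
    · refine ⟨x o, .inl ?_⟩
      simp [twistDist, positionQ, ho]
    · exact absurd rfl h

/-- The twins `y`, `z` share a position one step from `xᵢ` and two steps from `xᵢ₊₁`. With a gap of
one, `xᵢ₊₁` would also be midway between the twins, giving a cyclic line. -/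
theorem graphR3_dist {i : ℕ} (hn : 4 ≤ n) (hi : 1 ≤ i) (hin : i ≤ n - 3) (a b : StarVertex n) :
    (graphR3 n i).dist a b = twistDist (positionR n i) y z 2 a b := by
  have hf : graphR3 n i = WeightedGraph.ofEdges fun a b => ((match a, b with
      | x j, x k => if j.val + 1 = k.val ∧ j.val + 1 ≠ i then 1 else 0
      | y, x j => if j.val + 1 = i then 1 else if j.val + 1 = i + 1 then 2 else 0
      | z, x j => if j.val + 1 = i then 1 else if j.val + 1 = i + 1 then 2 else 0
      | _, _ => 0 : ℕ) : ℝ) := by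
    unfold graphR3
    congr 1
    funext a b
    cases a <;> cases b <;> simp
  rw [hf]
  refine WeightedGraph.ofEdges_natCast_dist_eq _ _ (twistDist_self (by simp)) twistDist_comm
    ?_ ?_ a b
  · rintro (j | _ | _) (k | _ | _) (l | _ | _) <;>
      simp [twistDist, positionR] <;> (try split_ifs) <;> omega
  · have step : ∀ j k : Fin (n - 2), j.val < k.val → ∃ l : Fin (n - 2), l.val = j.val + 1 :=
      fun j k h => ⟨⟨j + 1, by omega⟩, rfl⟩
    have pred : ∀ j : Fin (n - 2), ∃ l : Fin (n - 2), l.val = j.val - 1 :=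
      fun j => ⟨⟨j - 1, by omega⟩, rfl⟩
    obtain ⟨o, ho⟩ : ∃ l : Fin (n - 2), l.val + 1 = i := ⟨⟨i - 1, by omega⟩, by simp; omega⟩
    rintro (j | _ | _) (k | _ | _) h
    · obtain hlt | hlt : j.val < k.val ∨ k.val < j.val := by
        have : j.val ≠ k.val := fun e => h (by rw [Fin.ext e])
        omega
      -- The edge from `xᵢ` to `xᵢ₊₁` is missing, so the path crosses the gap through `y`.
      · by_cases hj : j.val + 1 = i
        · refine ⟨y, .inl ?_⟩
          simp [twistDist, positionR, hj]; split_ifs <;> omega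
        · obtain ⟨l, hl⟩ := step j k hlt
          refine ⟨x l, .inl ?_⟩
          simp [twistDist, positionR, Fin.ext_iff, hl, hj]; split_ifs <;> omega
      · by_cases hj : k.val + 1 = i
        · refine ⟨y, .inr ?_⟩
          simp [twistDist, positionR, hj]; split_ifs <;> omega
        · obtain ⟨l, hl⟩ := step k j hlt
          refine ⟨x l, .inr ?_⟩
          simp [twistDist, positionR, Fin.ext_iff, hl, hj]; split_ifs <;> omega
    · obtain hlt | hlt | hlt | hlt : j.val + 1 < i ∨ j.val + 1 = i ∨ j.val + 1 = i + 1 ∨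
          i + 1 < j.val + 1 := by omega
      · obtain ⟨l, hl⟩ := step j o (by omega)
        refine ⟨x l, .inl ?_⟩
        simp [twistDist, positionR, hl, Fin.ext_iff]; split_ifs <;> omega
      · refine ⟨y, .inl ?_⟩
        simp [twistDist, positionR, hlt]; omega
      · refine ⟨y, .inl ?_⟩
        simp [twistDist, positionR, hlt]; omega
      · obtain ⟨l, hl⟩ := pred j
        refine ⟨x l, .inl ?_⟩
        simp [twistDist, positionR, hl, Fin.ext_iff]; split_ifs <;> omega
    · obtain hlt | hlt | hlt | hlt : j.val + 1 < i ∨ j.val + 1 = i ∨ j.val + 1 = i + 1 ∨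
          i + 1 < j.val + 1 := by omega
      · obtain ⟨l, hl⟩ := step j o (by omega)
        refine ⟨x l, .inl ?_⟩
        simp [twistDist, positionR, hl, Fin.ext_iff]; split_ifs <;> omega
      · refine ⟨z, .inl ?_⟩
        simp [twistDist, positionR, hlt]; omega
      · refine ⟨z, .inl ?_⟩
        simp [twistDist, positionR, hlt]; omega
      · obtain ⟨l, hl⟩ := pred j
        refine ⟨x l, .inl ?_⟩
        simp [twistDist, positionR, hl, Fin.ext_iff]; split_ifs <;> omega
    · obtain hlt | hlt | hlt | hlt : k.val + 1 < i ∨ k.val + 1 = i ∨ k.val + 1 = i + 1 ∨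
          i + 1 < k.val + 1 := by omega
      · obtain ⟨l, hl⟩ := step k o (by omega)
        refine ⟨x l, .inr ?_⟩
        simp [twistDist, positionR, hl, Fin.ext_iff]; split_ifs <;> omega
      · refine ⟨y, .inr ?_⟩
        simp [twistDist, positionR, hlt]; omega
      · refine ⟨y, .inr ?_⟩
        simp [twistDist, positionR, hlt]; omega
      · obtain ⟨l, hl⟩ := pred k
        refine ⟨x l, .inr ?_⟩
        simp [twistDist, positionR, hl, Fin.ext_iff]; split_ifs <;> omega
    · exact absurd rfl h
    · refine ⟨x o, .inl ?_⟩
      simp [twistDist, positionR, ho]; omega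
    · obtain hlt | hlt | hlt | hlt : k.val + 1 < i ∨ k.val + 1 = i ∨ k.val + 1 = i + 1 ∨
          i + 1 < k.val + 1 := by omega
      · obtain ⟨l, hl⟩ := step k o (by omega)
        refine ⟨x l, .inr ?_⟩
        simp [twistDist, positionR, hl, Fin.ext_iff]; split_ifs <;> omega
      · refine ⟨z, .inr ?_⟩
        simp [twistDist, positionR, hlt]; omega
      · refine ⟨z, .inr ?_⟩
        simp [twistDist, positionR, hlt]; omega
      · obtain ⟨l, hl⟩ := pred k
        refine ⟨x l, .inr ?_⟩
        simp [twistDist, positionR, hl, Fin.ext_iff]; split_ifs <;> omega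
    · refine ⟨x o, .inl ?_⟩
      simp [twistDist, positionR, ho]; omega
    · exact absurd rfl h

theorem graphS3_dist (hn : 4 ≤ n) (a b : StarVertex n) :
    (graphS3 n).dist a b = twistDist (positionS n) y z (n - 2) a b := by
  have hf : graphS3 n = WeightedGraph.ofEdges fun a b => ((match a, b with
      | x j, x k => if j.val + 1 = k.val then 1 else 0
      | x j, y => if j.val + 1 = 1 then 1 else 0
      | x j, z => if j.val + 1 = n - 2 then 2 else 0
      | y, z => n - 2
      | _, _ => 0 : ℕ) : ℝ) := by
    unfold graphS3
    congr 1
    funext a b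
    cases a <;> cases b <;> simp
    rw [Nat.cast_sub (by omega)]; simp
  rw [hf]
  refine WeightedGraph.ofEdges_natCast_dist_eq _ _ (twistDist_self (by simp)) twistDist_comm
    ?_ ?_ a b
  · rintro (j | _ | _) (k | _ | _) (l | _ | _) <;>
      simp [twistDist, positionS] <;> (try split_ifs) <;> omega
  · have step : ∀ j k : Fin (n - 2), j.val < k.val → ∃ l : Fin (n - 2), l.val = j.val + 1 :=
      fun j k h => ⟨⟨j + 1, by omega⟩, rfl⟩
    have last : ∀ j : Fin (n - 2), j.val + 1 ≠ n - 2 → ∃ l : Fin (n - 2), l.val = j.val + 1 :=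
      fun j h => ⟨⟨j + 1, by omega⟩, rfl⟩
    obtain ⟨o, ho⟩ : ∃ l : Fin (n - 2), l.val = 0 := ⟨⟨0, by omega⟩, rfl⟩
    rintro (j | _ | _) (k | _ | _) h
    · obtain hlt | hlt : j.val < k.val ∨ k.val < j.val := by
        have : j.val ≠ k.val := fun e => h (by rw [Fin.ext e])
        omega
      · obtain ⟨l, hl⟩ := step j k hlt
        refine ⟨x l, .inl ?_⟩
        simp [twistDist, positionS, Fin.ext_iff, hl]; split_ifs <;> omega
      · obtain ⟨l, hl⟩ := step k j hlt
        refine ⟨x l, .inr ?_⟩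
        simp [twistDist, positionS, Fin.ext_iff, hl]; split_ifs <;> omega
    · refine ⟨x o, .inr ?_⟩
      simp [twistDist, positionS, ho]; omega
    · by_cases hj : j.val + 1 = n - 2
      · refine ⟨z, .inl ?_⟩
        simp [twistDist, positionS, hj]; omega
      · obtain ⟨l, hl⟩ := last j hj
        refine ⟨x l, .inl ?_⟩
        simp [twistDist, positionS, hl, Fin.ext_iff]; split_ifs <;> omega
    · refine ⟨x o, .inl ?_⟩
      simp [twistDist, positionS, ho]; omega
    · exact absurd rfl h
    · refine ⟨z, .inl ?_⟩
      simp [twistDist, positionS]; omega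
    · by_cases hj : k.val + 1 = n - 2
      · refine ⟨z, .inr ?_⟩
        simp [twistDist, positionS, hj]; omega
      · obtain ⟨l, hl⟩ := last k hj
        refine ⟨x l, .inr ?_⟩
        simp [twistDist, positionS, hl, Fin.ext_iff]; split_ifs <;> omega
    · refine ⟨z, .inr ?_⟩
      simp [twistDist, positionS]; omega
    · exact absurd rfl h

end Positions

/-! ### Extremal pairs: co-size, regularity, existence -/

namespace BetweennessStructure

variable {X : Type u} {B : BetweennessStructure X}

/-- The triangles of `B` are the triples `{y, z, x}` with `x ≠ s`. -/
structure IsExtremalPair (B : BetweennessStructure X) (y z s : X) : Prop where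
  ne : y ≠ z
  ne_left : s ≠ y
  ne_right : s ≠ z
  linear_left : ∀ a b c, a ≠ y → b ≠ y → c ≠ y → B.Collinear a b c
  linear_right : ∀ a b c, a ≠ z → b ≠ z → c ≠ z → B.Collinear a b c
  special : B.Collinear y z s
  triangle : ∀ x, x ≠ y → x ≠ z → x ≠ s → ¬ B.Collinear y z x

/-- A triple that misses `y` or `z` is collinear, so a triangle is determined by its third point. -/
theorem IsExtremalPair.triangles_eq [DecidableEq X] (hB : B.IsAlmostMetrizable) {y z s : X}
    (h : B.IsExtremalPair y z s) :
    B.triangles = (fun x => ({y, z, x} : Finset X)) '' ({y, z, s} : Set X)ᶜ := by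
  ext T
  constructor
  · intro hT
    obtain ⟨a, b, c, hab, hac, hbc, rfl⟩ := Finset.card_eq_three.1 hT.1
    rw [mem_triangles_iff hB hab hac hbc] at hT
    have hy : a = y ∨ b = y ∨ c = y := by
      by_contra! hn
      exact hT (h.linear_left _ _ _ hn.1 hn.2.1 hn.2.2)
    have hz : a = z ∨ b = z ∨ c = z := by
      by_contra! hn
      exact hT (h.linear_right _ _ _ hn.1 hn.2.1 hn.2.2)
    have hyz := h.ne
    have hsp := h.special
    have sw1 := fun a b c => (hB.collinear_swap_left (a := a) (b := b) (c := c)).1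
    have sw2 := fun a b c => (hB.collinear_swap_right (a := a) (b := b) (c := c)).1
    obtain ⟨x, hxy, hxz, hxs, e⟩ : ∃ x, x ≠ y ∧ x ≠ z ∧ x ≠ s ∧ ({y, z, x} : Finset X) = {a, b, c} := by
      rcases hy with rfl | rfl | rfl <;> rcases hz with rfl | rfl | rfl <;>
        first | exact absurd rfl hyz | skip
      · exact ⟨c, hac.symm, hbc.symm, by rintro rfl; exact hT hsp, rfl⟩
      · exact ⟨b, hab.symm, hbc, by rintro rfl; exact hT (sw2 _ _ _ hsp), by grind⟩
      · exact ⟨c, hbc.symm, hac.symm, by rintro rfl; exact hT (sw1 _ _ _ hsp), by grind⟩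
      · exact ⟨a, hab, hac, by rintro rfl; exact hT (sw1 _ _ _ (sw2 _ _ _ hsp)), by grind⟩
      · exact ⟨b, hbc, hab.symm, by rintro rfl; exact hT (sw2 _ _ _ (sw1 _ _ _ hsp)), by grind⟩
      · exact ⟨a, hac, hab,
          by rintro rfl; exact hT (sw1 _ _ _ (sw2 _ _ _ (sw1 _ _ _ hsp))), by grind⟩
    exact ⟨x, by simp [hxy, hxz, hxs], e⟩
  · rintro ⟨x, hx, rfl⟩
    simp only [Set.mem_compl_iff, Set.mem_insert_iff, Set.mem_singleton_iff, not_or] at hx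
    exact (mem_triangles_iff hB h.ne (Ne.symm hx.1) (Ne.symm hx.2.1)).2
      (h.triangle x hx.1 hx.2.1 hx.2.2)

theorem IsExtremalPair.coSize_eq [Finite X] (hB : B.IsAlmostMetrizable) {y z s : X}
    (h : B.IsExtremalPair y z s) : B.coSize = Nat.card X - 3 := by
  classical
  rw [coSize, h.triangles_eq hB, Set.InjOn.ncard_image, Set.ncard_compl]
  · congr 1
    exact Set.ncard_eq_three.2 ⟨y, z, s, h.ne, h.ne_left.symm, h.ne_right.symm, rfl⟩
  · intro a ha b hb e
    simp only [Set.mem_compl_iff, Set.mem_insert_iff, Set.mem_singleton_iff, not_or] at ha hb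
    have : a ∈ ({y, z, b} : Finset X) := by
      rw [← show ({y, z, a} : Finset X) = {y, z, b} from e]; simp
    simpa [ha.1, ha.2.1] using this

/-- All triples of a square are collinear. A square through both `y` and `z` has two further points,
one of them different from `s`, and that one forms a triangle with `y` and `z`. So only squares
avoiding `y` or `z` need to be excluded. -/
theorem IsExtremalPair.isRegular (hB : B.IsAlmostMetrizable) {y z s : X}
    (h : B.IsExtremalPair y z s)
    (hy : ∀ a b c d, a ≠ y → b ≠ y → c ≠ y → d ≠ y → ¬ B.IsSquare a b c d)
    (hz : ∀ a b c d, a ≠ z → b ≠ z → c ≠ z → d ≠ z → ¬ B.IsSquare a b c d) : B.IsRegular := by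
  rw [isRegular_iff hB]
  intro a b c d hs
  have hyz := h.ne
  have hsy := h.ne_left
  have hsz := h.ne_right
  have tri : ∀ x, x ≠ y → x ≠ z → x ≠ s → ¬ B.rel y z x ∧ ¬ B.rel z y x ∧ ¬ B.rel y x z ∧
      ¬ B.rel x z y ∧ ¬ B.rel x y z ∧ ¬ B.rel z x y := by
    intro x h1 h2 h3
    have ht := h.triangle x h1 h2 h3
    unfold Collinear at ht
    push Not at ht
    have c1 := mt (hB.symm x z y) ht.1
    have c2 := mt (hB.symm x y z) ht.2.1
    have c3 := mt (hB.symm z x y) ht.2.2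
    exact ⟨ht.1, ht.2.1, ht.2.2, c1, c2, c3⟩
  obtain ⟨ab, ac, ad, bc, bd, cd, abc, bcd, cda, dab⟩ := id hs
  have y_mem : a = y ∨ b = y ∨ c = y ∨ d = y := by
    by_contra! hn
    exact hy a b c d hn.1 hn.2.1 hn.2.2.1 hn.2.2.2 hs
  have z_mem : a = z ∨ b = z ∨ c = z ∨ d = z := by
    by_contra! hn
    exact hz a b c d hn.1 hn.2.1 hn.2.2.1 hn.2.2.2 hs
  have ta := tri a
  have tb := tri b
  have tc := tri c
  have td := tri d
  clear hs hy hz h tri hB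
  rcases y_mem with rfl | rfl | rfl | rfl <;> rcases z_mem with rfl | rfl | rfl | rfl <;>
    grind

/-- Only triples containing both `y` and `z` see the altered distance; for them the inequalities are
the hypothesis `tri`. -/
theorem twistDist_triangle {p : X → ℤ} {y z : X} {c : ℕ} (hyz : y ≠ z)
    (tri : ∀ x, x ≠ y → x ≠ z → c ≤ (p y - p x).natAbs + (p x - p z).natAbs ∧
      (p y - p x).natAbs ≤ c + (p x - p z).natAbs ∧
      (p x - p z).natAbs ≤ c + (p y - p x).natAbs) (a b t : X) :
    twistDist p y z c a t ≤ twistDist p y z c a b + twistDist p y z c b t := by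
  by_cases hy : a ≠ y ∧ b ≠ y ∧ t ≠ y
  · rw [twistDist_of_ne_left hy.1 hy.2.1, twistDist_of_ne_left hy.1 hy.2.2,
      twistDist_of_ne_left hy.2.1 hy.2.2]
    omega
  by_cases hz : a ≠ z ∧ b ≠ z ∧ t ≠ z
  · rw [twistDist_of_ne_right hz.1 hz.2.1, twistDist_of_ne_right hz.1 hz.2.2,
      twistDist_of_ne_right hz.2.1 hz.2.2]
    omega
  have key : ∀ w, (w = y ∨ w = z ∨
      (twistDist p y z c y w = (p y - p w).natAbs ∧ twistDist p y z c w z = (p w - p z).natAbs ∧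
      c ≤ (p y - p w).natAbs + (p w - p z).natAbs ∧ (p y - p w).natAbs ≤ c + (p w - p z).natAbs ∧
      (p w - p z).natAbs ≤ c + (p y - p w).natAbs)) := by
    intro w
    by_cases h1 : w = y
    · exact .inl h1
    by_cases h2 : w = z
    · exact .inr (.inl h2)
    exact .inr (.inr ⟨twistDist_of_ne_right hyz h2, twistDist_of_ne_left h1 hyz.symm, tri w h1 h2⟩)
  have e1 : twistDist p y z c y z = c := twistDist_left_right
  have e2 : twistDist p y z c z y = c := twistDist_right_left
  have e3 : twistDist p y z c y y = 0 := twistDist_self hyz y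
  have e4 : twistDist p y z c z z = 0 := twistDist_self hyz z
  have com := fun w => twistDist_comm (p := p) (y := y) (z := z) (c := c) y w
  have com' := fun w => twistDist_comm (p := p) (y := y) (z := z) (c := c) z w
  have hy' : a = y ∨ b = y ∨ t = y := by by_contra! h; exact hy h
  have hz' : a = z ∨ b = z ∨ t = z := by by_contra! h; exact hz h
  have ka := key a
  have kb := key b
  have kt := key t
  have ca := com a
  have ca' := com' a
  have cb := com b
  have cb' := com' b
  have ct := com t
  have ct' := com' t
  clear key com com' tri hy hz
  rcases hy' with h | h | h <;> rcases hz' with h' | h' | h' <;>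
    first
    | exact absurd (h.symm.trans h') hyz
    | (subst h h'
       first
       | (rcases ka with h | h | h <;> [subst h; subst h; skip] <;> omega)
       | (rcases kb with h | h | h <;> [subst h; subst h; skip] <;> omega)
       | (rcases kt with h | h | h <;> [subst h; subst h; skip] <;> omega))

/-- A line in which the distance of `y` and `z` is made too small for all points but `s`. -/
theorem isExtremalPair_twistDist {p : X → ℤ} {y z s : X} {c : ℕ} (hyz : y ≠ z) (hsy : s ≠ y)
    (hsz : s ≠ z) (hc : 0 < c) (hy : ∀ a b, a ≠ y → b ≠ y → p a = p b → a = b)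
    (hz : ∀ a b, a ≠ z → b ≠ z → p a = p b → a = b)
    (hx : ∀ x, x ≠ y → x ≠ z → x ≠ s → c < (p y - p x).natAbs + (p x - p z).natAbs ∧
      (p y - p x).natAbs < c + (p x - p z).natAbs ∧ (p x - p z).natAbs < c + (p y - p x).natAbs)
    (hs : c = (p y - p s).natAbs + (p s - p z).natAbs ∨
      (p y - p s).natAbs = c + (p s - p z).natAbs ∨ (p s - p z).natAbs = c + (p y - p s).natAbs) :
    (ofNatDist (twistDist p y z c)).IsAlmostMetrizable ∧
      (ofNatDist (twistDist p y z c)).IsExtremalPair y z s ∧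
      (ofNatDist (twistDist p y z c)).IsRegular := by
  have tri : ∀ x, x ≠ y → x ≠ z → c ≤ (p y - p x).natAbs + (p x - p z).natAbs ∧
      (p y - p x).natAbs ≤ c + (p x - p z).natAbs ∧
      (p x - p z).natAbs ≤ c + (p y - p x).natAbs := by
    intro x h1 h2
    by_cases hxs : x = s
    · subst hxs; omega
    · have := hx x h1 h2 hxs; omega
  have hB : (ofNatDist (twistDist p y z c)).IsAlmostMetrizable := by
    refine ofNatDist_isAlmostMetrizable _ (twistDist_self hyz) (fun a b h => ?_) twistDist_comm
      (fun a b t => ?_)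
    · have h1 := hy a b
      have h2 := hz a b
      unfold twistDist at h
      split_ifs at h with h3
      · omega
      · by_cases ha : a = y
        · by_cases hb : b = z
          · exact absurd (.inl ⟨ha, hb⟩) h3
          · exact h2 (ha ▸ hyz) hb (by omega)
        · by_cases hb : b = y
          · exact h2 (fun e => h3 (.inr ⟨e, hb⟩)) (hb ▸ hyz) (by omega)
          · exact h1 ha hb (by omega)
    · exact twistDist_triangle hyz tri a b t
  have rel_left : ∀ a b t, a ≠ y → b ≠ y → t ≠ y → ((ofNatDist (twistDist p y z c)).rel a b t ↔
      (p a - p t).natAbs = (p a - p b).natAbs + (p b - p t).natAbs) := by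
    intro a b t ha hb ht
    simp only [ofNatDist, twistDist_of_ne_left, ha, hb, ht, ne_eq, not_false_eq_true]
  have rel_right : ∀ a b t, a ≠ z → b ≠ z → t ≠ z → ((ofNatDist (twistDist p y z c)).rel a b t ↔
      (p a - p t).natAbs = (p a - p b).natAbs + (p b - p t).natAbs) := by
    intro a b t ha hb ht
    simp only [ofNatDist, twistDist_of_ne_right, ha, hb, ht, ne_eq, not_false_eq_true]
  have col : ∀ x, x ≠ y → x ≠ z → ((ofNatDist (twistDist p y z c)).Collinear y z x ↔
      (p y - p x).natAbs = c + (p x - p z).natAbs ∨ (p x - p z).natAbs = c + (p y - p x).natAbs ∨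
      c = (p y - p x).natAbs + (p x - p z).natAbs) := by
    intro x h1 h2
    simp only [Collinear, ofNatDist, twistDist_left_right, twistDist_right_left]
    rw [twistDist_of_ne_right (a := y) (b := x) hyz h2, twistDist_of_ne_left (a := x) (b := z) h1 hyz.symm,
      twistDist_comm z x, twistDist_of_ne_left (a := x) (b := z) h1 hyz.symm]
  have hE : (ofNatDist (twistDist p y z c)).IsExtremalPair y z s := by
    refine ⟨hyz, hsy, hsz, fun a b t ha hb ht => ?_, fun a b t ha hb ht => ?_, ?_,
      fun x h1 h2 h3 => ?_⟩
    · rw [Collinear, rel_left _ _ _ ha hb ht, rel_left _ _ _ hb ha ht, rel_left _ _ _ ha ht hb]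
      omega
    · rw [Collinear, rel_right _ _ _ ha hb ht, rel_right _ _ _ hb ha ht, rel_right _ _ _ ha ht hb]
      omega
    · rw [col s hsy hsz]; omega
    · rw [col x h1 h2]
      have := hx x h1 h2 h3
      omega
  -- Off `y`, and off `z`, the structure is a set of distinct integers, which contains no square.
  refine ⟨hB, hE, hE.isRegular hB (fun a b t d ha hb ht hd h => ?_)
    (fun a b t d ha hb ht hd h => ?_)⟩
  · have h1 := (rel_left _ _ _ ha hb ht).1 h.abc
    have h2 := (rel_left _ _ _ hb ht hd).1 h.bcd
    have h3 := (rel_left _ _ _ ht hd ha).1 h.cda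
    have h4 := (rel_left _ _ _ hd ha hb).1 h.dab
    have n1 := mt (hy _ _ ha hb) h.ne_ab
    have n2 := mt (hy _ _ ha ht) h.ne_ac
    have n3 := mt (hy _ _ ha hd) h.ne_ad
    clear hx hs tri
    omega
  · have h1 := (rel_right _ _ _ ha hb ht).1 h.abc
    have h2 := (rel_right _ _ _ hb ht hd).1 h.bcd
    have h3 := (rel_right _ _ _ ht hd ha).1 h.cda
    have h4 := (rel_right _ _ _ hd ha hb).1 h.dab
    have n1 := mt (hz _ _ ha hb) h.ne_ab
    have n2 := mt (hz _ _ ha ht) h.ne_ac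
    have n3 := mt (hz _ _ ha hd) h.ne_ad
    clear hx hs tri
    omega

/-- The triangles of an extremal structure share two points and miss just one of the others. -/
theorem exists_isExtremalPair [Finite X] (hB : B.IsAlmostMetrizable) (hreg : B.IsRegular)
    (hcard : 4 ≤ Nat.card X) (hco : B.coSize = Nat.card X - 3) :
    ∃ y z s, B.IsExtremalPair y z s := by
  classical
  have := Fintype.ofFinite X
  have hmem : ∀ T, T ∈ B.triangles.toFinite.toFinset ↔ T ∈ B.triangles := by simp
  have hH := isSparseFree_of_isRegular hB hreg hmem
  have hfil : B.triangles.toFinite.toFinset.filter (· ⊆ Finset.univ) =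
      B.triangles.toFinite.toFinset := by simp
  have hc : B.triangles.toFinite.toFinset.card = B.coSize :=
    (Set.ncard_eq_toFinset_card _ _).symm
  rw [Nat.card_eq_fintype_card] at hcard hco
  obtain ⟨y, z, hyz, hall⟩ := hH.exists_common_pair Finset.univ (by simpa using hcard)
    (by rw [hfil, hc, hco, Finset.card_univ])
  rw [hfil] at hall
  have hall' : ∀ T ∈ B.triangles, y ∈ T ∧ z ∈ T := fun T hT => hall T ((hmem T).2 hT)
  have left : ∀ w, (∀ T ∈ B.triangles, w ∈ T) → ∀ a b c, a ≠ w → b ≠ w → c ≠ w →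
      B.Collinear a b c := by
    intro w hw a b c ha hb hc
    by_cases hab : a = b
    · exact .inl (hab ▸ hB.left_self _ _)
    by_cases hbc : b = c
    · exact .inl (hbc ▸ hB.right_self _ _)
    by_cases hac : a = c
    · exact .inr (.inl (hac ▸ hB.right_self _ _))
    by_contra hn
    have := hw _ ((mem_triangles_iff hB hab hac hbc).2 hn)
    simp [Ne.symm ha, Ne.symm hb, Ne.symm hc] at this
  -- Every triangle is `{y, z, x}` with `x` in `P`. As `P` has `n - 2` points and there are `n - 3`
  -- triangles, exactly one point of `P` is left over: `s`.
  let P : Finset X := Finset.univ.filter fun x => x ≠ y ∧ x ≠ z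
  let A : Finset X := P.filter fun x => ¬ B.Collinear y z x
  have hP : P.card = Fintype.card X - 2 := by
    have : P = Finset.univ \ {y, z} := by ext; simp [P]
    rw [this, Finset.card_sdiff_of_subset (Finset.subset_univ _), Finset.card_univ,
      Finset.card_pair hyz]
  have hA : A.card = Fintype.card X - 3 := by
    rw [← hco, ← hc]
    refine Finset.card_bij (fun x _ => {y, z, x}) (fun x hx => ?_) (fun a ha b hb e => ?_)
      (fun T hT => ?_)
    · simp only [A, P, Finset.mem_filter, Finset.mem_univ, true_and] at hx
      exact (hmem _).2 ((mem_triangles_iff hB hyz hx.1.1.symm hx.1.2.symm).2 hx.2)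
    · simp only [A, P, Finset.mem_filter, Finset.mem_univ, true_and] at ha hb
      have : a ∈ ({y, z, b} : Finset X) := by rw [← e]; simp
      simpa [ha.1.1, ha.1.2] using this
    · rw [hmem] at hT
      obtain ⟨hy, hz⟩ := hall' T hT
      have hsub : ({y, z} : Finset X) ⊆ T := by
        intro w hw
        rw [Finset.mem_insert, Finset.mem_singleton] at hw
        rcases hw with rfl | rfl <;> assumption
      have h1 := Finset.card_sdiff_of_subset hsub
      rw [hT.1, Finset.card_pair hyz] at h1
      obtain ⟨x, hx⟩ := Finset.card_eq_one.1 h1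
      have hxm : x ∈ T \ {y, z} := by simp [hx]
      simp only [Finset.mem_sdiff, Finset.mem_insert, Finset.mem_singleton, not_or] at hxm
      have e : ({y, z, x} : Finset X) = T := by
        rw [← Finset.union_sdiff_of_subset hsub, hx]
        ext; simp
      refine ⟨x, ?_, e⟩
      rw [← e, mem_triangles_iff hB hyz (Ne.symm hxm.2.1) (Ne.symm hxm.2.2)] at hT
      simp only [A, P, Finset.mem_filter, Finset.mem_univ, true_and]
      exact ⟨hxm.2, hT⟩
  have hs := Finset.card_sdiff_of_subset (Finset.filter_subset (fun x => ¬ B.Collinear y z x) P)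
  rw [show (P.filter fun x => ¬ B.Collinear y z x) = A from rfl, hA, hP] at hs
  obtain ⟨s, hs⟩ := Finset.card_eq_one.1 (hs.trans (show _ = 1 by omega))
  have key : ∀ x, (x ≠ y ∧ x ≠ z) ∧ B.Collinear y z x ↔ x = s := by
    intro x
    have := Finset.ext_iff.1 hs x
    simp only [A, P, Finset.mem_sdiff, Finset.mem_filter, Finset.mem_univ, true_and,
      Finset.mem_singleton] at this
    rw [← this]
    grind
  obtain ⟨⟨h1, h2⟩, h3⟩ := (key s).2 rfl
  exact ⟨y, z, s, hyz, h1, h2, left y fun T hT => (hall' T hT).1,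
    left z fun T hT => (hall' T hT).2, h3, fun x hy hz hs hn => hs ((key x).1 ⟨⟨hy, hz⟩, hn⟩)⟩

end BetweennessStructure

/-! ### Identifying the extremal structures -/

theorem StarVertex.natCard {n : ℕ} (hn : 2 ≤ n) : Nat.card (StarVertex n) = n := by
  let e : StarVertex n ≃ Option (Option (Fin (n - 2))) :=
    { toFun := fun v => match v with
        | .x k => some (some k)
        | .y => some none
        | .z => none
      invFun := fun v => match v with
        | some (some k) => .x k
        | some none => .y
        | none => .z
      left_inv := by rintro (_ | _ | _) <;> rfl
      right_inv := by rintro (_ | _ | _) <;> rfl }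
  rw [Nat.card_congr e, Nat.card_eq_fintype_card, Fintype.card_option, Fintype.card_option,
    Fintype.card_fin]
  omega

theorem StarVertex.exists_equiv {X : Type u} [Finite X] {n : ℕ} (hn : 2 ≤ n)
    (hX : Nat.card X = n) {y z : X} (hyz : y ≠ z) (i : X → ℕ)
    (hi : ∀ a, a ≠ y → a ≠ z → i a < n - 2)
    (inj : ∀ a b, a ≠ y → a ≠ z → b ≠ y → b ≠ z → i a = i b → a = b) :
    ∃ e : X ≃ StarVertex n, e y = .y ∧ e z = .z ∧
      ∀ a, a ≠ y → a ≠ z → ∃ k, e a = .x k ∧ k.val = i a := by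
  classical
  let F : X → StarVertex n := fun a =>
    if hy : a = y then .y else if hz : a = z then .z else .x ⟨i a, hi a hy hz⟩
  have hF : Function.Injective F := by
    intro a b h
    by_cases ay : a = y <;> by_cases az : a = z <;> by_cases b_y : b = y <;>
      by_cases bz : b = z <;> simp [F, ay, az, b_y, bz] at h ⊢ <;>
      first | exact inj a b ay az b_y bz h | simp_all
  have : Finite (StarVertex n) :=
    Nat.finite_of_card_ne_zero (by rw [StarVertex.natCard hn]; omega)
  have hbij : Function.Bijective F :=
    (Nat.bijective_iff_injective_and_card F).2 ⟨hF, by rw [hX, StarVertex.natCard hn]⟩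
  refine ⟨Equiv.ofBijective F hbij, ?_, ?_, fun a ay az => ⟨⟨i a, hi a ay az⟩, ?_, rfl⟩⟩
  · simp [F]
  · simp [F, hyz.symm]
  · simp [F, ay, az]

namespace BetweennessStructure

variable {X : Type u} {B C : BetweennessStructure X} {y z s : X}

theorem IsExtremalPair.symm (hB : B.IsAlmostMetrizable) (h : B.IsExtremalPair y z s) :
    B.IsExtremalPair z y s where
  ne := h.ne.symm
  ne_left := h.ne_right
  ne_right := h.ne_left
  linear_left := h.linear_right
  linear_right := h.linear_left
  special := hB.collinear_swap_left.1 h.special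
  triangle x h1 h2 h3 h4 := h.triangle x h2 h1 h3 (hB.collinear_swap_left.1 h4)

/-- Two structures with the same extremal pair agree if they agree off either of its points. -/
theorem IsExtremalPair.rel_iff (hB : B.IsAlmostMetrizable) (hC : C.IsAlmostMetrizable)
    (h : B.IsExtremalPair y z s) (h' : C.IsExtremalPair y z s)
    (hl : ∀ a b t, a ≠ y → b ≠ y → t ≠ y → (B.rel a b t ↔ C.rel a b t))
    (hr : ∀ a b t, a ≠ z → b ≠ z → t ≠ z → (B.rel a b t ↔ C.rel a b t))
    (hs : (B.rel y s z ∧ C.rel y s z) ∨ (B.rel s y z ∧ C.rel s y z)) (a b t : X) :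
    B.rel a b t ↔ C.rel a b t := by
  have hyz := h.ne
  -- Triples through both `y` and `z` agree as well: the third point gives a triangle in both
  -- structures, or it is `s`, whose position is fixed by `hs`.
  have key : ∀ x, (B.rel y z x ↔ C.rel y z x) ∧ (B.rel z y x ↔ C.rel z y x) ∧
      (B.rel y x z ↔ C.rel y x z) := by
    intro x
    by_cases hxy : x = y
    · subst hxy
      simp [hB.rel_self_iff, hC.rel_self_iff, hB.right_self, hC.right_self, hB.left_self,
        hC.left_self]
    by_cases hxz : x = z
    · subst hxz
      simp [hB.rel_self_iff, hC.rel_self_iff, hB.right_self, hC.right_self]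
    by_cases hxs : x = s
    · subst hxs
      rcases hs with ⟨h1, h2⟩ | ⟨h1, h2⟩
      · have n1 := mt (hB.symm _ _ _) (hB.not_left h1 (Ne.symm hxy))
        have n2 := hB.not_right h1 hxz
        have n3 := mt (hC.symm _ _ _) (hC.not_left h2 (Ne.symm hxy))
        have n4 := hC.not_right h2 hxz
        simp [n2, n4, n1, n3, h1, h2]
      · have n1 := hB.not_left h1 hxy
        have n2 := mt (hB.symm y z x) (hB.not_right h1 hyz)
        have n3 := hC.not_left h2 hxy
        have n4 := mt (hC.symm y z x) (hC.not_right h2 hyz)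
        simp [n2, n4, n1, n3, hB.symm _ _ _ h1, hC.symm _ _ _ h2]
    · have h1 := h.triangle x hxy hxz hxs
      have h2 := h'.triangle x hxy hxz hxs
      unfold Collinear at h1 h2
      tauto
  by_cases hy : a ≠ y ∧ b ≠ y ∧ t ≠ y
  · exact hl a b t hy.1 hy.2.1 hy.2.2
  by_cases hz : a ≠ z ∧ b ≠ z ∧ t ≠ z
  · exact hr a b t hz.1 hz.2.1 hz.2.2
  have hy' : a = y ∨ b = y ∨ t = y := by by_contra! h; exact hy h
  have hz' : a = z ∨ b = z ∨ t = z := by by_contra! h; exact hz h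
  rcases hy' with rfl | rfl | rfl <;> rcases hz' with rfl | rfl | rfl <;>
    first | exact absurd rfl hyz | skip
  · exact (key t).1
  · exact (key b).2.2
  · exact (key t).2.1
  · rw [hB.comm, hC.comm]; exact (key a).2.1
  · rw [hB.comm, hC.comm]; exact (key b).2.2
  · rw [hB.comm, hC.comm]; exact (key a).1

theorem isIsomorphic_of_position {n c : ℕ} {W : WeightedGraph (StarVertex n)}
    {pos : StarVertex n → ℤ} (hW : ∀ a b, W.dist a b = twistDist pos .y .z c a b)
    (e : X ≃ StarVertex n) (hy : e y = .y) (hz : e z = .z) {p : X → ℤ}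
    (hp : ∀ a, pos (e a) = p a)
    (hrel : ∀ a b t, B.rel a b t ↔ (ofNatDist (twistDist p y z c)).rel a b t) :
    B.IsIsomorphic W.betweenness := by
  refine ⟨e, fun a b t => ?_⟩
  have hd : ∀ a b, twistDist pos .y .z c (e a) (e b) = twistDist p y z c a b := by
    intro a b
    unfold twistDist
    rw [← hy, ← hz, hp, hp]
    congr 1
    simp
  rw [hrel, betweenness_rel_iff W _ hW]
  simp only [ofNatDist, hd]

section Classification

variable [Finite X]

theorem exists_isRankOn_compl (hB : B.IsAlmostMetrizable) (hreg : B.IsRegular) (w : X)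
    (hlin : ∀ a b c, a ≠ w → b ≠ w → c ≠ w → B.Collinear a b c) :
    ∃ (S : Finset X) (f : X → ℕ), S.card = Nat.card X - 1 ∧ (∀ a, a ∈ S ↔ a ≠ w) ∧
      B.IsRankOn S f := by
  classical
  have := Fintype.ofFinite X
  obtain ⟨f, hf⟩ := exists_isRankOn (S := Finset.univ.erase w) hB ((isRegular_iff hB).1 hreg)
    (fun a ha b hb c hc => hlin a b c (by simpa using ha) (by simpa using hb) (by simpa using hc))
  exact ⟨_, f, by rw [Finset.card_erase_of_mem (Finset.mem_univ _), Finset.card_univ,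
    Nat.card_eq_fintype_card], fun a => by simp, hf⟩

/-- Order the complement of `z`, insert `z` at the position of `y`, and compare with the resulting
twisted line. -/
theorem isIsomorphic_of_twins (hB : B.IsAlmostMetrizable) (hreg : B.IsRegular)
    (hcard : 4 ≤ Nat.card X) (h : B.IsExtremalPair y z s) (hs : B.rel y s z) :
    B.IsIsomorphic (graphQ3 (Nat.card X)).betweenness ∨
      ∃ i, 1 ≤ i ∧ i ≤ Nat.card X - 3 ∧
        B.IsIsomorphic (graphR3 (Nat.card X) i).betweenness := by
  classical
  have hyz := h.ne
  have hsy := h.ne_left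
  have hsz := h.ne_right
  have twin : ∀ x, x ≠ y → x ≠ z → x ≠ s →
      (B.rel y s x ∧ B.rel z s x) ∨ (B.rel s y x ∧ B.rel s z x) := fun x hxy hxz hxs =>
    of_rel_mid hB hxy hxz (h.triangle x hxy hxz hxs) (h.linear_right _ _ _ hsz hyz hxz)
      (h.linear_left _ _ _ hsy hyz.symm hxy) hs
  obtain ⟨S, f, hSc, hS, hf⟩ : ∃ (S : Finset X) (f : X → ℕ), S.card = Nat.card X - 1 ∧
      (∀ a, a ∈ S ↔ a ≠ z) ∧ B.IsRankOn S f ∧ f s < f y := by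
    obtain ⟨S, f, hSc, hS, hf⟩ := exists_isRankOn_compl hB hreg z h.linear_right
    have h1 := hf.lt s ((hS _).2 hsz)
    have h2 := hf.lt y ((hS _).2 hyz)
    rcases lt_trichotomy (f s) (f y) with h3 | h3 | h3
    · exact ⟨S, f, hSc, hS, hf, h3⟩
    · exact absurd (hf.inj _ ((hS _).2 hsz) _ ((hS _).2 hyz) h3) hsy
    · exact ⟨S, _, hSc, hS, hf.rev, by omega⟩
  obtain ⟨hf, hlt⟩ := hf
  obtain ⟨S', g, hSc', hS', hg⟩ := exists_isRankOn_compl hB hreg y h.linear_left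
  have frel : ∀ a b c, a ≠ z → b ≠ z → c ≠ z →
      (B.rel a b c ↔ (f a ≤ f b ∧ f b ≤ f c) ∨ (f c ≤ f b ∧ f b ≤ f a)) := fun a b c ha hb hc =>
    hf.rel_iff a ((hS _).2 ha) b ((hS _).2 hb) c ((hS _).2 hc)
  have grel : ∀ a b c, a ≠ y → b ≠ y → c ≠ y →
      (B.rel a b c ↔ (g a ≤ g b ∧ g b ≤ g c) ∨ (g c ≤ g b ∧ g b ≤ g a)) := fun a b c ha hb hc =>
    hg.rel_iff a ((hS' _).2 ha) b ((hS' _).2 hb) c ((hS' _).2 hc)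
  have finj : ∀ a b, a ≠ z → b ≠ z → f a = f b → a = b := fun a b ha hb =>
    hf.inj a ((hS _).2 ha) b ((hS _).2 hb)
  have ginj : ∀ a b, a ≠ y → b ≠ y → g a = g b → a = b := fun a b ha hb =>
    hg.inj a ((hS' _).2 ha) b ((hS' _).2 hb)
  have flt : ∀ a, a ≠ z → f a < Nat.card X - 1 := fun a ha => hSc ▸ hf.lt a ((hS _).2 ha)
  -- By `twin`, no further point lies between `s` and `y`.
  have adj : f y = f s + 1 := by
    by_contra hne
    have := flt y hyz
    obtain ⟨x, hx, hfx⟩ := hf.surj (k := f s + 1) (by omega)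
    rw [hS] at hx
    have hxy : x ≠ y := by rintro rfl; omega
    have hxs : x ≠ s := by rintro rfl; omega
    rcases twin x hxy hx hxs with ⟨h1, -⟩ | ⟨h1, -⟩
    · rw [frel _ _ _ hyz hsz hx] at h1; omega
    · rw [frel _ _ _ hsz hyz hx] at h1; omega
  -- `y` and `z` are interchangeable
  have side : ∀ x, x ≠ y → x ≠ z → x ≠ s →
      (f x < f s ∧ ((g z < g s ∧ g s < g x) ∨ (g x < g s ∧ g s < g z))) ∨
      (f y < f x ∧ ((g s < g z ∧ g z < g x) ∨ (g x < g z ∧ g z < g s))) := by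
    intro x hxy hxz hxs
    have n1 := mt (finj x s hxz hsz) hxs
    have n2 := mt (finj x y hxz hyz) hxy
    have n3 := mt (ginj x s hxy hsy) hxs
    have n4 := mt (ginj x z hxy hyz.symm) hxz
    have n5 := mt (ginj s z hsy hyz.symm) hsz
    rcases twin x hxy hxz hxs with ⟨h1, h2⟩ | ⟨h1, h2⟩
    · rw [frel _ _ _ hyz hsz hxz] at h1
      rw [grel _ _ _ hyz.symm hsy hxy] at h2
      omega
    · rw [frel _ _ _ hsz hyz hxz] at h1
      rw [grel _ _ _ hsy hyz.symm hxy] at h2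
      omega
  -- The orders `f` and `g` agree off `y` and `z` up to reversal, as triples through `s` show, and
  -- `side` puts `z` in `g` where `y` is in `f`.
  have swap : ∀ x x', x ≠ y → x ≠ z → x' ≠ y → x' ≠ z →
      (B.rel z x x' ↔ B.rel y x x') ∧ (B.rel x z x' ↔ B.rel x y x') := by
    intro x x' hxy hxz hxy' hxz'
    have r1 := (frel s x x' hsz hxz hxz').symm.trans (grel s x x' hsy hxy hxy')
    have r2 := (frel x s x' hxz hsz hxz').symm.trans (grel x s x' hxy hsy hxy')
    have r3 := (frel s x' x hsz hxz' hxz).symm.trans (grel s x' x hsy hxy' hxy)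
    have n5 := mt (ginj s z hsy hyz.symm) hsz
    rw [frel _ _ _ hyz hxz hxz', frel _ _ _ hxz hyz hxz', grel _ _ _ hyz.symm hxy hxy',
      grel _ _ _ hxy hyz.symm hxy']
    by_cases hxs : x = s
    · subst hxs
      by_cases hxs' : x' = x
      · subst hxs'; omega
      · have := side x' hxy' hxz' hxs'
        omega
    · have k1 := side x hxy hxz hxs
      by_cases hxs' : x' = s
      · subst hxs'; omega
      · have k2 := side x' hxy' hxz' hxs'
        clear side twin
        rcases k1 with ⟨_, _ | _⟩ | ⟨_, _ | _⟩ <;> rcases k2 with ⟨_, _ | _⟩ | ⟨_, _ | _⟩ <;>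
          omega
  -- Points beyond `y` move up by one. This leaves a gap of two after the twins, so that only `s` is
  -- at distance one from both.
  let p : X → ℤ := fun a => if a = z then f y else if f a ≤ f y then f a else f a + 1
  have pz : p z = f y := by simp [p]
  have pa : ∀ a, a ≠ z → (f a ≤ f y ∧ p a = f a) ∨ (f y < f a ∧ p a = f a + 1) := by
    intro a ha
    by_cases hle : f a ≤ f y
    · exact .inl ⟨hle, by simp [p, ha, hle]⟩
    · exact .inr ⟨by omega, by simp [p, ha, hle]⟩
  have py := pa y hyz
  obtain ⟨hC, hE, -⟩ := isExtremalPair_twistDist (p := p) (c := 2) hyz hsy hsz two_pos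
    (fun a b ha hb e => by
      by_cases haz : a = z
      · by_cases hbz : b = z
        · rw [haz, hbz]
        · have := pa b hbz
          have := mt (finj b y hbz hyz) hb
          rw [haz, pz] at e
          omega
      · have h1 := pa a haz
        by_cases hbz : b = z
        · have := mt (finj a y haz hyz) ha
          rw [hbz, pz] at e
          omega
        · have h2 := pa b hbz
          exact finj a b haz hbz (by omega))
    (fun a b ha hb e => by
      have h1 := pa a ha
      have h2 := pa b hb
      exact finj a b ha hb (by omega))
    (fun x hxy hxz hxs => by
      have h1 := pa x hxz
      have h2 := mt (finj x y hxz hyz) hxy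
      have h3 := mt (finj x s hxz hsz) hxs
      rw [pz]
      omega)
    (by
      have h1 := pa s hsz
      rw [pz]
      omega)
  have Crel : ∀ a b t, a ≠ z → b ≠ z → t ≠ z →
      (B.rel a b t ↔ (ofNatDist (twistDist p y z 2)).rel a b t) := by
    intro a b t ha hb ht
    have h1 := pa a ha
    have h2 := pa b hb
    have h3 := pa t ht
    rw [frel a b t ha hb ht]
    simp only [ofNatDist, twistDist_of_ne_right, ne_eq, ha, hb, ht, not_false_eq_true]
    omega
  have hrel := h.rel_iff hB hC hE
    (fun a b t ha hb ht => by
      have hpp : p z = p y := by omega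
      have e1 : ∀ x x', x ≠ y → x' ≠ y →
          twistDist p y z 2 x x' = (p x - p x').natAbs := fun _ _ => twistDist_of_ne_left
      have e2 : ∀ x x', x ≠ z → x' ≠ z →
          twistDist p y z 2 x x' = (p x - p x').natAbs := fun _ _ => twistDist_of_ne_right
      have out : ∀ x x', x ≠ y → x ≠ z → x' ≠ y → x' ≠ z →
          (B.rel z x x' ↔ (ofNatDist (twistDist p y z 2)).rel z x x') ∧
          (B.rel x z x' ↔ (ofNatDist (twistDist p y z 2)).rel x z x') := by
        intro x x' h1 h2 h3 h4
        rw [(swap x x' h1 h2 h3 h4).1, (swap x x' h1 h2 h3 h4).2, Crel _ _ _ hyz h2 h4,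
          Crel _ _ _ h2 hyz h4]
        simp only [ofNatDist, e1 _ _ h1 h3, e1 _ _ hyz.symm h1, e1 _ _ hyz.symm h3,
          e1 _ _ h1 hyz.symm, e2 _ _ hyz h2, e2 _ _ hyz h4, e2 _ _ h2 hyz, hpp, and_self]
      by_cases haz : a = z
      · subst haz
        by_cases hbz : b = a
        · subst hbz
          simp [hB.left_self, hC.left_self]
        by_cases htz : t = a
        · subst htz
          simp [hB.rel_self_iff, hC.rel_self_iff]
        exact (out b t hb hbz ht htz).1
      by_cases hbz : b = z
      · subst hbz
        by_cases htz : t = b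
        · subst htz
          simp [hB.right_self, hC.right_self]
        exact (out a t ha haz ht htz).2
      by_cases htz : t = z
      · subst htz
        rw [hB.comm, hC.comm]
        exact (out b a hb hbz ha haz).1
      exact Crel a b t haz hbz htz)
    Crel (.inl ⟨hs, by
      simp only [ofNatDist, twistDist_left_right]
      rw [twistDist_of_ne_right hyz hsz, twistDist_of_ne_left hsy hyz.symm, pz]
      have := pa s hsz
      omega⟩)
  have fy := flt y hyz
  -- If `y` is last, the gap has nothing behind it and the graph is `Q`, numbered backwards from `s
  -- = x₁`. Otherwise it is `R` with `i = f y`, since `s = xᵢ` has rank `i - 1`.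
  by_cases hlast : f y = Nat.card X - 2
  · left
    obtain ⟨e, ey, ez, ex⟩ := StarVertex.exists_equiv (by omega) rfl hyz
      (fun a => Nat.card X - 3 - f a) (fun a hay haz => by omega)
      (fun a b ha ha' hb hb' e => finj a b ha' hb' (by
        have := flt a ha'
        have := flt b hb'
        have := mt (finj a y ha' hyz) ha
        have := mt (finj b y hb' hyz) hb
        omega))
    refine isIsomorphic_of_position (fun a b => graphQ3_dist hcard a b) e ey ez (fun a => ?_) hrel
    by_cases hay : a = y
    · rw [hay, ey]; simp only [positionQ]; omega
    by_cases haz : a = z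
    · rw [haz, ez]; simp only [positionQ]; omega
    obtain ⟨k, hk, hk'⟩ := ex a hay haz
    have := flt a haz
    have := mt (finj a y haz hyz) hay
    have := pa a haz
    rw [hk]; simp only [positionQ]; omega
  · right
    refine ⟨f y, by omega, by omega, ?_⟩
    obtain ⟨e, ey, ez, ex⟩ := StarVertex.exists_equiv (by omega) rfl hyz
      (fun a => if f a < f y then f a else f a - 1)
      (fun a hay haz => by have := flt a haz; split_ifs <;> omega)
      (fun a b ha ha' hb hb' e => finj a b ha' hb' (by
        have := mt (finj a y ha' hyz) ha
        have := mt (finj b y hb' hyz) hb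
        split_ifs at e <;> omega))
    refine isIsomorphic_of_position (fun a b => graphR3_dist hcard (by omega) (by omega) a b)
      e ey ez (fun a => ?_) hrel
    by_cases hay : a = y
    · rw [hay, ey]; simp only [positionR]; omega
    by_cases haz : a = z
    · rw [haz, ez]; simp only [positionR]; omega
    obtain ⟨k, hk, hk'⟩ := ex a hay haz
    have := mt (finj a y haz hyz) hay
    have := pa a haz
    rw [hk]; simp only [positionR]
    split_ifs at hk' ⊢ <;> omega

/-- By `opp`, every further point is separated from `y` by `s` and lies between `s` and `z`. This
fixes the start `y`, `s` of one order and the ends `s`, `z` of the other. -/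
theorem isIsomorphic_graphS3 (hB : B.IsAlmostMetrizable) (hreg : B.IsRegular)
    (hcard : 4 ≤ Nat.card X) (h : B.IsExtremalPair y z s) (hs : B.rel s y z) :
    B.IsIsomorphic (graphS3 (Nat.card X)).betweenness := by
  classical
  have hyz := h.ne
  have hsy := h.ne_left
  have hsz := h.ne_right
  have opp : ∀ x, x ≠ y → x ≠ z → x ≠ s → B.rel s x z ∧ B.rel x s y := fun x hxy hxz hxs =>
    of_rel_left hB hsy (h.triangle x hxy hxz hxs) (h.linear_right _ _ _ hsz hyz hxz)
      (h.linear_left _ _ _ hsy hyz.symm hxy) hs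
  obtain ⟨S, f, hSc, hS, hf, hlt⟩ : ∃ (S : Finset X) (f : X → ℕ), S.card = Nat.card X - 1 ∧
      (∀ a, a ∈ S ↔ a ≠ z) ∧ B.IsRankOn S f ∧ f y < f s := by
    obtain ⟨S, f, hSc, hS, hf⟩ := exists_isRankOn_compl hB hreg z h.linear_right
    have h1 := hf.lt s ((hS _).2 hsz)
    have h2 := hf.lt y ((hS _).2 hyz)
    rcases lt_trichotomy (f y) (f s) with h3 | h3 | h3
    · exact ⟨S, f, hSc, hS, hf, h3⟩
    · exact absurd (hf.inj _ ((hS _).2 hsz) _ ((hS _).2 hyz) h3.symm) hsy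
    · exact ⟨S, _, hSc, hS, hf.rev, by omega⟩
  obtain ⟨S', g, hSc', hS', hg⟩ := exists_isRankOn_compl hB hreg y h.linear_left
  have frel : ∀ a b c, a ≠ z → b ≠ z → c ≠ z →
      (B.rel a b c ↔ (f a ≤ f b ∧ f b ≤ f c) ∨ (f c ≤ f b ∧ f b ≤ f a)) := fun a b c ha hb hc =>
    hf.rel_iff a ((hS _).2 ha) b ((hS _).2 hb) c ((hS _).2 hc)
  have grel : ∀ a b c, a ≠ y → b ≠ y → c ≠ y →
      (B.rel a b c ↔ (g a ≤ g b ∧ g b ≤ g c) ∨ (g c ≤ g b ∧ g b ≤ g a)) := fun a b c ha hb hc =>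
    hg.rel_iff a ((hS' _).2 ha) b ((hS' _).2 hb) c ((hS' _).2 hc)
  have finj : ∀ a b, a ≠ z → b ≠ z → f a = f b → a = b := fun a b ha hb =>
    hf.inj a ((hS _).2 ha) b ((hS _).2 hb)
  have ginj : ∀ a b, a ≠ y → b ≠ y → g a = g b → a = b := fun a b ha hb =>
    hg.inj a ((hS' _).2 ha) b ((hS' _).2 hb)
  have flt : ∀ a, a ≠ z → f a < Nat.card X - 1 := fun a ha => hSc ▸ hf.lt a ((hS _).2 ha)
  have above : ∀ x, x ≠ y → x ≠ z → x ≠ s → f s < f x := by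
    intro x hxy hxz hxs
    have h1 := (opp x hxy hxz hxs).2
    rw [frel _ _ _ hxz hsz hyz] at h1
    have := mt (finj x s hxz hsz) hxs
    omega
  have fy : f y = 0 := by
    obtain ⟨x, hx, hfx⟩ := hf.surj (k := 0) (by omega)
    rw [hS] at hx
    by_cases hxy : x = y
    · rw [← hxy, hfx]
    by_cases hxs : x = s
    · subst hxs; omega
    · have := above x hxy hx hxs; omega
  have fs : f s = 1 := by
    obtain ⟨x, hx, hfx⟩ := hf.surj (k := 1) (by omega)
    rw [hS] at hx
    by_cases hxy : x = y
    · subst hxy; omega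
    by_cases hxs : x = s
    · rw [← hxs, hfx]
    · have := above x hxy hx hxs; omega
  -- The ranks fill `0, …, n - 2`, and `z` goes to `n`, two steps after the last of them. Shortening
  -- the distance of `y` and `z` from `n` to `n - 2` places `y` between `s`, at position `1`, and
  -- `z`; all other points satisfy strict triangle inequalities with `y` and `z`.
  let p : X → ℤ := fun a => if a = z then (Nat.card X : ℤ) else f a
  have pz : p z = Nat.card X := by simp [p]
  have pa : ∀ a, a ≠ z → p a = f a := fun a ha => by simp [p, ha]
  have py := pa y hyz
  have ps := pa s hsz
  obtain ⟨hC, hE, -⟩ := isExtremalPair_twistDist (p := p) (c := Nat.card X - 2) hyz hsy hsz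
    (by omega)
    (fun a b ha hb e => by
      by_cases haz : a = z
      · by_cases hbz : b = z
        · rw [haz, hbz]
        · have := pa b hbz
          have := flt b hbz
          rw [haz, pz] at e
          omega
      · have h1 := pa a haz
        have := flt a haz
        by_cases hbz : b = z
        · rw [hbz, pz] at e
          omega
        · have h2 := pa b hbz
          exact finj a b haz hbz (by omega))
    (fun a b ha hb e => by
      have h1 := pa a ha
      have h2 := pa b hb
      exact finj a b ha hb (by omega))
    (fun x hxy hxz hxs => by
      have h1 := pa x hxz
      have h2 := flt x hxz
      have h3 := above x hxy hxz hxs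
      omega)
    (by omega)
  have Crel : ∀ a b t, a ≠ z → b ≠ z → t ≠ z →
      (B.rel a b t ↔ (ofNatDist (twistDist p y z (Nat.card X - 2))).rel a b t) := by
    intro a b t ha hb ht
    have h1 := pa a ha
    have h2 := pa b hb
    have h3 := pa t ht
    rw [frel a b t ha hb ht]
    simp only [ofNatDist, twistDist_of_ne_right, ne_eq, ha, hb, ht, not_false_eq_true]
    omega
  -- In the order `g` all points lie from `s` on towards `z`, so comparison with `s` transfers the
  -- order `f` to `g`, with `z` at the far end.
  have gs : ∀ x, x ≠ y → x ≠ z → f s ≤ f x ∧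
      ((g s ≤ g x ∧ g x < g z) ∨ (g z < g x ∧ g x ≤ g s)) := by
    intro x hxy hxz
    have n1 := mt (ginj x z hxy hyz.symm) hxz
    by_cases hxs : x = s
    · subst hxs; omega
    · have h1 := (opp x hxy hxz hxs).1
      rw [grel _ _ _ hsy hxy hyz.symm] at h1
      have := above x hxy hxz hxs
      omega
  have hrel := h.rel_iff hB hC hE
    (fun a b t ha hb ht => by
      have out : ∀ x x', x ≠ y → x ≠ z → x' ≠ y → x' ≠ z →
          (B.rel z x x' ↔ (ofNatDist (twistDist p y z (Nat.card X - 2))).rel z x x') ∧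
          (B.rel x z x' ↔ (ofNatDist (twistDist p y z (Nat.card X - 2))).rel x z x') := by
        intro x x' h1 h2 h3 h4
        have r1 := (frel s x' x hsz h4 h2).symm.trans (grel s x' x hsy h3 h1)
        have g1 := gs x h1 h2
        have g2 := gs x' h3 h4
        have l1 := flt x h2
        have l2 := flt x' h4
        have p1 := pa x h2
        have p2 := pa x' h4
        have i1 := finj x x' h2 h4
        have i2 := ginj x x' h1 h3
        rw [grel _ _ _ hyz.symm h1 h3, grel _ _ _ h1 hyz.symm h3]
        simp only [ofNatDist]
        rw [twistDist_of_ne_left hyz.symm h1, twistDist_of_ne_left hyz.symm h3,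
          twistDist_of_ne_left h1 h3, twistDist_of_ne_left h1 hyz.symm]
        clear gs above opp
        constructor <;> omega
      by_cases haz : a = z
      · subst haz
        by_cases hbz : b = a
        · subst hbz
          simp [hB.left_self, hC.left_self]
        by_cases htz : t = a
        · subst htz
          simp [hB.rel_self_iff, hC.rel_self_iff]
        exact (out b t hb hbz ht htz).1
      by_cases hbz : b = z
      · subst hbz
        by_cases htz : t = b
        · subst htz
          simp [hB.right_self, hC.right_self]
        exact (out a t ha haz ht htz).2
      by_cases htz : t = z
      · subst htz
        rw [hB.comm, hC.comm]
        exact (out b a hb hbz ha haz).1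
      exact Crel a b t haz hbz htz)
    Crel (.inr ⟨hs, by
      simp only [ofNatDist, twistDist_left_right]
      rw [twistDist_of_ne_right hsz hyz, twistDist_of_ne_left hsy hyz.symm]
      omega⟩)
  obtain ⟨e, ey, ez, ex⟩ := StarVertex.exists_equiv (by omega) rfl hyz
    (fun a => f a - 1)
    (fun a hay haz => by have := flt a haz; omega)
    (fun a b ha ha' hb hb' e => finj a b ha' hb' (by
      have := (gs a ha ha').1
      have := (gs b hb hb').1
      omega))
  refine isIsomorphic_of_position (fun a b => graphS3_dist hcard a b) e ey ez (fun a => ?_) hrel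
  by_cases hay : a = y
  · rw [hay, ey]; simp only [positionS]; omega
  by_cases haz : a = z
  · rw [haz, ez]; simp only [positionS]; omega
  obtain ⟨k, hk, hk'⟩ := ex a hay haz
  have := (gs a hay haz).1
  have := pa a haz
  rw [hk]; simp only [positionS]; omega

end Classification


/-! ### The minimum and the structures attaining it -/

variable {X : Type u} {B : BetweennessStructure X}

theorem coSize_pos_iff [Finite X] : 0 < B.coSize ↔ ¬ B.IsLinear := by
  rw [coSize, Set.ncard_pos]
  simp only [triangles, IsLinear, Set.Nonempty, Set.mem_ofPred_eq]
  push Not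
  rfl

theorem max_le_coSize [Finite X] (hB : B.IsAlmostMetrizable) (hreg : B.IsRegular)
    (hpos : 0 < B.coSize) : max 1 (Nat.card X - 3) ≤ B.coSize := by
  classical
  have := Fintype.ofFinite X
  have hH := isSparseFree_of_isRegular hB hreg
    (show ∀ T, T ∈ B.triangles.toFinite.toFinset ↔ T ∈ B.triangles by simp)
  have hc : B.triangles.toFinite.toFinset.card = B.coSize :=
    (Set.ncard_eq_toFinset_card _ _).symm
  have hfil : B.triangles.toFinite.toFinset.filter (· ⊆ Finset.univ) =
      B.triangles.toFinite.toFinset := by simp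
  have := hH.le_card Finset.univ (by rw [hfil, ← Finset.card_pos, hc]; exact hpos)
  rw [hfil, hc, Finset.card_univ, ← Nat.card_eq_fintype_card] at this
  omega

/-- The examples live on types in universe `0`; a lifted copy of `Fin` carries them to the universe
of `Realizable`. -/
theorem realizable_of_isRegular {Y : Type v} [Finite Y] {C : BetweennessStructure Y}
    (hC : C.IsAlmostMetrizable) (hreg : C.IsRegular) :
    Realizable.{u} (fun _ B => B.IsRegular) (Nat.card Y) C.coSize := by
  let e : ULift.{u} (Fin (Nat.card Y)) ≃ Y := Equiv.ulift.trans (Finite.equivFin Y).symm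
  let D : BetweennessStructure (ULift.{u} (Fin (Nat.card Y))) :=
    ⟨fun a b c => C.rel (e a) (e b) (e c)⟩
  have h : D.IsIsomorphic C := ⟨e, fun _ _ _ => Iff.rfl⟩
  exact ⟨_, inferInstance, D, by simp, h.symm.isAlmostMetrizable hC, h.symm.isRegular hC hreg,
    h.coSize_eq⟩

theorem betweenness_eq_ofNatDist (W : WeightedGraph X) (d : X → X → ℕ)
    (h : ∀ a b, W.dist a b = d a b) : W.betweenness = ofNatDist d := by
  have : W.betweenness.rel = (ofNatDist d).rel := by
    funext a b c
    exact propext (betweenness_rel_iff W d h a b c)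
  exact congrArg mk this

theorem graphQ3_isExtremalPair {n : ℕ} (hn : 4 ≤ n) :
    (graphQ3 n).betweenness.IsAlmostMetrizable ∧
      (∃ s, (graphQ3 n).betweenness.IsExtremalPair .y .z s) ∧
      (graphQ3 n).betweenness.IsRegular := by
  rw [betweenness_eq_ofNatDist _ _ (graphQ3_dist hn)]
  obtain ⟨h1, h2, h3⟩ := isExtremalPair_twistDist (p := positionQ n) (y := .y) (z := .z)
    (s := .x ⟨0, by omega⟩) (c := 2) (by simp) (by simp) (by simp) two_pos
    (by rintro (j | _ | _) (k | _ | _) <;> simp [positionQ, Fin.ext_iff] <;> omega)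
    (by rintro (j | _ | _) (k | _ | _) <;> simp [positionQ, Fin.ext_iff] <;> omega)
    (by rintro (j | _ | _) <;> simp [positionQ, Fin.ext_iff] <;> omega)
    (by simp [positionQ])
  exact ⟨h1, ⟨_, h2⟩, h3⟩

theorem graphR3_isExtremalPair {n i : ℕ} (hn : 4 ≤ n) (hi : 1 ≤ i) (hin : i ≤ n - 3) :
    (graphR3 n i).betweenness.IsAlmostMetrizable ∧
      (∃ s, (graphR3 n i).betweenness.IsExtremalPair .y .z s) ∧
      (graphR3 n i).betweenness.IsRegular := by
  rw [betweenness_eq_ofNatDist _ _ (graphR3_dist hn hi hin)]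
  -- The exceptional point is `xᵢ`, which has index `i - 1`.
  obtain ⟨h1, h2, h3⟩ := isExtremalPair_twistDist (p := positionR n i) (y := .y) (z := .z)
    (s := .x ⟨i - 1, by omega⟩) (c := 2) (by simp) (by simp) (by simp) two_pos
    (by rintro (j | _ | _) (k | _ | _) <;> simp [positionR, Fin.ext_iff] <;> split_ifs <;> omega)
    (by rintro (j | _ | _) (k | _ | _) <;> simp [positionR, Fin.ext_iff] <;> split_ifs <;> omega)
    (by rintro (j | _ | _) <;> simp [positionR, Fin.ext_iff] <;> split_ifs <;> omega)
    (by simp [positionR]; split_ifs <;> omega)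
  exact ⟨h1, ⟨_, h2⟩, h3⟩

theorem graphS3_isExtremalPair {n : ℕ} (hn : 4 ≤ n) :
    (graphS3 n).betweenness.IsAlmostMetrizable ∧
      (∃ s, (graphS3 n).betweenness.IsExtremalPair .y .z s) ∧
      (graphS3 n).betweenness.IsRegular := by
  rw [betweenness_eq_ofNatDist _ _ (graphS3_dist hn)]
  obtain ⟨h1, h2, h3⟩ := isExtremalPair_twistDist (p := positionS n) (y := .y) (z := .z)
    (s := .x ⟨0, by omega⟩) (c := n - 2) (by simp) (by simp) (by simp) (by omega)
    (by rintro (j | _ | _) (k | _ | _) <;> simp [positionS, Fin.ext_iff] <;> omega)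
    (by rintro (j | _ | _) (k | _ | _) <;> simp [positionS, Fin.ext_iff] <;> omega)
    (by rintro (j | _ | _) <;> simp [positionS, Fin.ext_iff] <;> omega)
    (by simp [positionS]; omega)
  exact ⟨h1, ⟨_, h2⟩, h3⟩

theorem completeThree_isAlmostMetrizable : completeThree.IsAlmostMetrizable := by
  constructor <;> simp only [completeThree_rel_iff_eq] <;> decide

theorem completeThree_isRegular : completeThree.IsRegular := by
  rw [isRegular_iff completeThree_isAlmostMetrizable]
  rintro a b c d ⟨h1, h2, h3, h4, h5, h6, -, -, -, -⟩
  omega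

theorem completeThree_coSize : completeThree.coSize = 1 := by
  rw [coSize, Set.ncard_eq_one]
  refine ⟨Finset.univ, Set.eq_singleton_iff_unique_mem.2 ⟨?_, fun T hT => ?_⟩⟩
  · have : (Finset.univ : Finset (Fin 3)) = {0, 1, 2} := by decide
    rw [this, mem_triangles_iff completeThree_isAlmostMetrizable (by decide) (by decide)
      (by decide)]
    unfold Collinear
    simp only [completeThree_rel_iff_eq]
    decide
  · exact Finset.card_eq_iff_eq_univ _ |>.1 (by simpa using hT.1)

theorem isTau_max {n : ℕ} (hn : 3 ≤ n) :
    IsTau.{u} (fun _ B => B.IsRegular) n 0 (max 1 (n - 3)) := by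
  refine ⟨⟨by omega, ?_⟩, ?_⟩
  · obtain rfl | h4 : n = 3 ∨ 4 ≤ n := by omega
    · have := realizable_of_isRegular.{u} completeThree_isAlmostMetrizable completeThree_isRegular
      rwa [completeThree_coSize, Nat.card_eq_fintype_card, Fintype.card_fin] at this
    · obtain ⟨h1, ⟨s, h2⟩, h3⟩ := graphQ3_isExtremalPair h4
      have hcard := StarVertex.natCard (n := n) (by omega)
      have : Finite (StarVertex n) := Nat.finite_of_card_ne_zero (by omega)
      have := realizable_of_isRegular.{u} h1 h3
      rwa [h2.coSize_eq h1, hcard, show n - 3 = max 1 (n - 3) by omega] at this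
  · rintro m ⟨hm, X, _, B, rfl, hB, hreg, rfl⟩
    exact max_le_coSize hB hreg hm

theorem minimal_of_isExtremalPair [Finite X] {n : ℕ} (hn : 4 ≤ n)
    {C : BetweennessStructure (StarVertex n)}
    (hC : C.IsAlmostMetrizable ∧ (∃ s, C.IsExtremalPair .y .z s) ∧ C.IsRegular)
    (h : B.IsIsomorphic C) : B.IsAlmostMetrizable ∧ B.IsRegular ∧ ¬ B.IsLinear ∧
      IsTau.{u} (fun _ C => C.IsRegular) (Nat.card X) 0 B.coSize := by
  obtain ⟨h1, ⟨s, h2⟩, h3⟩ := hC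
  have hY := StarVertex.natCard (n := n) (by omega)
  have : Finite (StarVertex n) := Nat.finite_of_card_ne_zero (by omega)
  have hcard : Nat.card X = n := by
    obtain ⟨e, -⟩ := h
    rw [Nat.card_congr e, hY]
  have hco : B.coSize = max 1 (n - 3) := by
    rw [h.coSize_eq, h2.coSize_eq h1, hY]; omega
  refine ⟨h.symm.isAlmostMetrizable h1, h.symm.isRegular h1 h3, coSize_pos_iff.1 (by omega), ?_⟩
  rw [hcard, hco]
  exact isTau_max (by omega)

/-- A nonlinear structure of order three is a single triangle, so only the degenerate relations
hold. -/
theorem isIsomorphic_completeThree [Finite X] (hB : B.IsAlmostMetrizable)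
    (hcard : Nat.card X = 3) (hlin : ¬ B.IsLinear) : B.IsIsomorphic completeThree := by
  classical
  have := Fintype.ofFinite X
  refine ⟨Finite.equivFinOfCardEq hcard, fun x y t => ?_⟩
  rw [completeThree_rel_iff_eq, EmbeddingLike.apply_eq_iff_eq, EmbeddingLike.apply_eq_iff_eq]
  constructor
  · intro h
    by_contra! hne
    have hxt : x ≠ t := by
      rintro rfl
      exact hne.1 (hB.rel_self_iff.1 h)
    refine hlin fun T hT => ?_
    rw [Nat.card_eq_fintype_card] at hcard
    have hTu : T = Finset.univ := (Finset.card_eq_iff_eq_univ T).1 (hT.trans hcard.symm)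
    have hxu : ({x, y, t} : Finset X) = Finset.univ := (Finset.card_eq_iff_eq_univ _).1
      ((Finset.card_eq_three.2 ⟨x, y, t, hne.1, hxt, hne.2, rfl⟩).trans hcard.symm)
    rw [hTu, ← hxu, hB.isCollinear_iff hne.1 hxt hne.2]
    exact .inl h
  · rintro (rfl | rfl)
    · exact hB.left_self _ _
    · exact hB.right_self _ _

/-- The nonlinear regular structures of minimum co-size. -/
theorem minimal_iff [Finite X] (B : BetweennessStructure X) :
    (B.IsAlmostMetrizable ∧ B.IsRegular ∧ ¬ B.IsLinear ∧
      IsTau.{u} (fun _ C => C.IsRegular) (Nat.card X) 0 B.coSize) ↔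
    ((∃ n : ℕ, 4 ≤ n ∧ B.IsIsomorphic (graphQ3 n).betweenness) ∨
      (∃ n i : ℕ, 4 ≤ n ∧ 1 ≤ i ∧ i ≤ n - 3 ∧ B.IsIsomorphic (graphR3 n i).betweenness) ∨
      (∃ n : ℕ, 4 ≤ n ∧ B.IsIsomorphic (graphS3 n).betweenness) ∨
      B.IsIsomorphic completeThree) := by
  constructor
  · rintro ⟨hB, hreg, hlin, htau⟩
    have hcard : 3 ≤ Nat.card X := by
      have := Fintype.ofFinite X
      unfold IsLinear at hlin
      push Not at hlin
      obtain ⟨T, hT, -⟩ := hlin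
      rw [← hT, Nat.card_eq_fintype_card]
      exact Finset.card_le_univ T
    obtain h3 | h4 : Nat.card X = 3 ∨ 4 ≤ Nat.card X := by omega
    · exact .inr (.inr (.inr (isIsomorphic_completeThree hB h3 hlin)))
    have hco := htau.unique (isTau_max hcard)
    obtain ⟨y, z, s, h⟩ := exists_isExtremalPair hB hreg h4 (by omega)
    -- The three cases are the middle point of `y`, `z`, `s`. If it is `z`, the extremal pair is
    -- reversed to reach the case in which it is `y`.
    rcases h.special with hs | hs | hs
    · exact .inr (.inr (.inl ⟨_, h4,
        isIsomorphic_graphS3 hB hreg h4 (h.symm hB) (hB.symm _ _ _ hs)⟩))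
    · exact .inr (.inr (.inl ⟨_, h4, isIsomorphic_graphS3 hB hreg h4 h (hB.symm _ _ _ hs)⟩))
    · rcases isIsomorphic_of_twins hB hreg h4 h hs with hq | ⟨i, hi, hin, hr⟩
      · exact .inl ⟨_, h4, hq⟩
      · exact .inr (.inl ⟨_, i, h4, hi, hin, hr⟩)
  · rintro (⟨n, hn, h⟩ | ⟨n, i, hn, hi, hin, h⟩ | ⟨n, hn, h⟩ | h)
    · exact minimal_of_isExtremalPair hn (graphQ3_isExtremalPair hn) h
    · exact minimal_of_isExtremalPair hn (graphR3_isExtremalPair hn hi hin) h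
    · exact minimal_of_isExtremalPair hn (graphS3_isExtremalPair hn) h
    · have hcard : Nat.card X = 3 := by
        obtain ⟨e, -⟩ := h
        rw [Nat.card_congr e, Nat.card_eq_fintype_card, Fintype.card_fin]
      have hco : B.coSize = 1 := by rw [h.coSize_eq, completeThree_coSize]
      refine ⟨h.symm.isAlmostMetrizable completeThree_isAlmostMetrizable,
        h.symm.isRegular completeThree_isAlmostMetrizable completeThree_isRegular,
        coSize_pos_iff.1 (by omega), ?_⟩
      rw [hcard, hco]
      exact isTau_max (le_refl 3)

end BetweennessStructure

theorem theorem2 :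
    (∀ n : ℕ, 3 ≤ n →
      BetweennessStructure.IsTau.{u} (fun _ B => B.IsRegular) n 0 (max 1 (n - 3))) ∧
    (∀ (X : Type u) [Finite X] (B : BetweennessStructure X),
      (B.IsAlmostMetrizable ∧ B.IsRegular ∧ ¬ B.IsLinear ∧
        BetweennessStructure.IsTau.{u} (fun _ C => C.IsRegular) (Nat.card X) 0 B.coSize) ↔
      ((∃ n : ℕ, 4 ≤ n ∧ B.IsIsomorphic (graphQ3 n).betweenness) ∨
        (∃ n i : ℕ, 4 ≤ n ∧ 1 ≤ i ∧ i ≤ n - 3 ∧ B.IsIsomorphic (graphR3 n i).betweenness) ∨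
        (∃ n : ℕ, 4 ≤ n ∧ B.IsIsomorphic (graphS3 n).betweenness) ∨
        B.IsIsomorphic completeThree)) :=
  ⟨fun _ hn => BetweennessStructure.isTau_max hn,
    fun _ _ B => BetweennessStructure.minimal_iff B⟩
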